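/- Let $n\in\mathbb N$. Write $\langle\xi\rangle=(1+|\xi|^2)^{1/2}$ for $\xi\in\mathbb R^n$, let $\mathcal F\varphi(\xi)=(2\pi)^{-n/2}\int_{\mathbb R^n}e^{ix\cdot\xi}\varphi(x)\,dx$ on $\mathcal S(\mathbb R^n)$, and extend $\mathcal F$ by duality to the tempered distributions $\mathcal S'=\mathcal S'(\mathbb R^n)$. Modulation spaces. Fix a smooth function $\rho:\mathbb R^n\to[0,1]$ with $\operatorname{supp}\rho\subset[-1,1]^n$ and $\rho=1$ on $[-\frac12,\frac12]^n$. For $k\in\mathbb Z^n$ put $\rho_k(\xi)=\rho(\xi-k)$, $\sigma_k=\rho_k\big(\sum_{l\in\mathbb Z^n}\rho_l\big)^{-1}$ and $\Box_kf=\mathcal F^{-1}[\sigma_k\mathcal Ff]$ for $f\in\mathcal S'$. For $1\le p,q\le\infty$ and $s\in\mathbb R$ let $M^s_{p,q}$ be the space of all $f\in\mathcal S'$ with $$\|f\|_{M^s_{p,q}}=\Big(\sum_{k\in\mathbb Z^n}\langle k\rangle^{sq}\,\|\Box_kf\|_{L_p}^q\Big)^{1/q}<\infty$$ (supremum over $k$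 if $q=\infty$). Orthant pieces. For $R>0$ and $\epsilon=(\epsilon_1,\dots,\epsilon_n)\in\{0,1\}^n$ let $$P_R(\epsilon)=\{\xi\in\mathbb R^n:\ \operatorname{sign}(\xi_j)=(-1)^{\epsilon_j},\ j=1,\dots,n\}\setminus[-R,R]^n,$$ $$M^s_{p,q}(\epsilon,R)=\{f\in M^s_{p,q}:\ \operatorname{supp}\mathcal Ff\subset P_R(\epsilon)\}.$$ Products. For $f,g\in\mathcal S'$ the product is $f\cdot g=\lim_{j\to\infty}S^jf\cdot S^jg$ (limit in $\mathcal S'$), whenever this limit exists, where $S^jf=\mathcal F^{-1}[\psi(2^{-j}\,\cdot)\mathcal Ff]$ and $\psi\in C_0^\infty(\mathbb R^n)$ equals $1$ near the origin; it is understood that the limit exists for every such $\psi$ and does not depend on $\psi$. **Proposition 4.3.** Let $1\le p_1,p_2\le\infty$, $1<q\le\infty$, $\frac1q+\frac1{q'}=1$, and $s_0,s_1,s_2\in\mathbb R$. Define $p$ by $\frac1p=\frac1{p_1}+\frac1{p_2}$ and assume $p\in[1,\infty]$, $s_0\le\min(s_1,s_2)$, $s_1,s_2\ge0$ and $s_1+s_2-s_0>n/q'$.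 Then there exists a constant $c>0$ (depending only on $n,p_1,p_2,q,s_0,s_1,s_2$ and $\rho$) such that for all $R>2$, all $\epsilon\in\{0,1\}^n$, all $f\in M^{s_1}_{p_1,q}(\epsilon,R)$ and all $g\in M^{s_2}_{p_2,q}(\epsilon,R)$ the product $f\cdot g$ exists in $\mathcal S'$, belongs to $M^{s_0}_{p,q}$ and satisfies $$\|f\cdot g\|_{M^{s_0}_{p,q}}\le c\,(R-2)^{-[(s_1+s_2-s_0)-n/q']}\,\|f\|_{M^{s_1}_{p_1,q}}\,\|g\|_{M^{s_2}_{p_2,q}}.$$ -/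

import Mathlib

open MeasureTheory Filter Topology SchwartzMap FourierTransform
open scoped ENNReal ContDiff

namespace ModulationSpaces

noncomputable section

/-- Euclidean space `ℝⁿ`. -/
abbrev Eu (n : ℕ) : Type := EuclideanSpace ℝ (Fin n)

/-! ### The Fourier transform with kernel `(2π)^{-n/2} e^{i x·ξ}` -/

/-- Dilation `φ ↦ φ(a ·)`, `a ≠ 0`, on Schwartz functions. -/
def dilate {n : ℕ} (a : ℝ) (ha : a ≠ 0) : 𝓢(Eu n, ℂ) →L[ℂ] 𝓢(Eu n, ℂ) :=
  compCLMOfContinuousLinearEquiv ℂ (ContinuousLinearEquiv.smulLeft (Units.mk0 a ha))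

theorem dilate_apply {n : ℕ} (a : ℝ) (ha : a ≠ 0) (φ : 𝓢(Eu n, ℂ)) (x : Eu n) :
    dilate a ha φ x = φ (a • x) := rfl

theorem inv_two_pi_ne_zero : (2 * Real.pi)⁻¹ ≠ 0 := inv_ne_zero Real.two_pi_pos.ne'

/-- The normalizing factor `(2π)^{-n/2}`. -/
def normFactor (n : ℕ) : ℝ := (2 * Real.pi) ^ (-(n : ℝ) / 2)

/-- `(F φ)(ξ) = (2π)^{-n/2} ∫ e^{i x·ξ} φ(x) dx` on Schwartz functions; the explicit formula is
`fourierS_apply` below. -/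
def fourierS (n : ℕ) : 𝓢(Eu n, ℂ) →L[ℂ] 𝓢(Eu n, ℂ) :=
  (normFactor n : ℂ) • (dilate (2 * Real.pi)⁻¹ inv_two_pi_ne_zero ∘L fourierInvCLM ℂ 𝓢(Eu n, ℂ))

theorem fourierS_apply {n : ℕ} (φ : 𝓢(Eu n, ℂ)) (ξ : Eu n) :
    fourierS n φ ξ
      = (normFactor n : ℂ) * ∫ x, Complex.exp (Complex.I * (inner ℝ x ξ : ℝ)) * φ x := by
  have h : fourierS n φ ξ = (normFactor n : ℂ) * (𝓕⁻ φ) ((2 * Real.pi)⁻¹ • ξ) := rfl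
  rw [h, fourierInv_coe, Real.fourierInv_eq']
  congr 1
  refine integral_congr_ae (ae_of_all _ fun x => ?_)
  simp only [smul_eq_mul, inner_smul_right]
  congr 2
  have : (Real.pi : ℂ) ≠ 0 := by exact_mod_cast Real.pi_ne_zero
  push_cast
  field_simp

/-- The Fourier transform of a tempered distribution, `⟨F f, φ⟩ = ⟨f, F φ⟩`. -/
def fourierD {n : ℕ} (f : 𝓢'(Eu n, ℂ)) : 𝓢'(Eu n, ℂ) :=
  PointwiseConvergenceCLM.precomp ℂ (fourierS n) f

theorem fourierD_apply {n : ℕ} (f : 𝓢'(Eu n, ℂ)) (φ : 𝓢(Eu n, ℂ)) :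
    fourierD f φ = f (fourierS n φ) := rfl

/-- The character `ξ ↦ e^{-i x·ξ}`. -/
def character {n : ℕ} (x ξ : Eu n) : ℂ := Complex.exp (-(Complex.I * (inner ℝ x ξ : ℝ)))

theorem character_hasTemperateGrowth {n : ℕ} (x : Eu n) :
    (character x).HasTemperateGrowth := by
  have hd : ∀ m : ℕ, iteratedDeriv m (fun t : ℝ => Complex.exp (-(Complex.I * (t : ℂ))))
      = fun t : ℝ => (-Complex.I) ^ m * Complex.exp (-(Complex.I * (t : ℂ))) := by
    intro m
    induction m with
    | zero => simp
    | succ m ih =>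
      rw [iteratedDeriv_succ, ih]
      funext t
      have h1 : HasDerivAt (fun t : ℝ => -(Complex.I * (t : ℂ))) (-(Complex.I * 1)) t :=
        ((Complex.ofRealCLM.hasDerivAt (x := t)).const_mul Complex.I).neg
      rw [((h1.cexp).const_mul ((-Complex.I) ^ m)).deriv]
      ring
  have hexp : (fun t : ℝ => Complex.exp (-(Complex.I * (t : ℂ)))).HasTemperateGrowth := by
    refine ⟨?_, fun m => ⟨0, 1, fun t => ?_⟩⟩
    · exact (contDiff_const.mul Complex.ofRealCLM.contDiff).neg.cexp
    · rw [norm_iteratedFDeriv_eq_norm_iteratedDeriv, hd]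
      have : ‖Complex.exp (-(Complex.I * (t : ℂ)))‖ = 1 := by simp [Complex.norm_exp]
      simp [this]
  exact hexp.comp (innerSL ℝ x).hasTemperateGrowth

/-- For a Schwartz symbol `m`, the function
`F⁻¹[m F f](x) = (2π)^{-n/2} ⟨F f, m e^{-i x·(·)}⟩`. For every tempered distribution `f` this is
the smooth function of polynomial growth that represents the distribution `F⁻¹[m F f]`. -/
def fourierMul {n : ℕ} (m : 𝓢(Eu n, ℂ)) (f : 𝓢'(Eu n, ℂ)) (x : Eu n) : ℂ :=
  (normFactor n : ℂ) * fourierD f (smulLeftCLM ℂ (character x) m)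

/-- The same function as a convolution: `F⁻¹[m F f](x) = (2π)^{-n/2} ⟨f, (F m)(· - x)⟩`, where
`(F m)(y - x) = (F⁻¹ m)(x - y)`. -/
theorem fourierMul_eq {n : ℕ} (m : 𝓢(Eu n, ℂ)) (f : 𝓢'(Eu n, ℂ)) (x : Eu n) :
    fourierMul m f x = (normFactor n : ℂ) * f (compSubConstCLM ℂ x (fourierS n m)) := by
  rw [fourierMul, fourierD_apply]
  congr 2
  ext y
  rw [compSubConstCLM_apply, fourierS_apply, fourierS_apply]
  congr 1
  refine integral_congr_ae (ae_of_all _ fun t => ?_)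
  simp only [smulLeftCLM_apply_apply (character_hasTemperateGrowth x), smul_eq_mul, character]
  rw [← mul_assoc, ← Complex.exp_add, inner_sub_right, real_inner_comm x t]
  congr 2
  push_cast
  ring

/-! ### The frequency-uniform decomposition -/

/-- The point of `ℝⁿ` with integer coordinates `k`. -/
def latticePt {n : ℕ} (k : Fin n → ℤ) : Eu n := WithLp.toLp 2 fun i => (k i : ℝ)

/-- A smooth function `ρ : ℝⁿ → [0,1]`, supported in the cube `[-1,1]ⁿ`, equal to `1` on
`[-1/2,1/2]ⁿ`. -/
structure Window (n : ℕ) where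
  toFun : Eu n → ℝ
  smooth : ContDiff ℝ ∞ toFun
  mem_Icc : ∀ ξ, toFun ξ ∈ Set.Icc (0 : ℝ) 1
  support_subset : tsupport toFun ⊆ {ξ | ∀ i, |ξ i| ≤ 1}
  eq_one : ∀ ξ : Eu n, (∀ i, |ξ i| ≤ 1 / 2) → toFun ξ = 1

namespace Window

variable {n : ℕ} (ρ : Window n)

/-- `ρ_k(ξ) = ρ(ξ - k)`. -/
def translate (k : Fin n → ℤ) (ξ : Eu n) : ℝ := ρ.toFun (ξ - latticePt k)

/-- `∑_{k ∈ ℤⁿ} ρ_k(ξ)`; for every `ξ` only finitely many summands are nonzero. -/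
def total (ξ : Eu n) : ℝ := ∑ᶠ k : Fin n → ℤ, ρ.translate k ξ

/-- `σ_k = ρ_k / ∑_l ρ_l`. -/
def sigma (k : Fin n → ℤ) (ξ : Eu n) : ℝ := ρ.translate k ξ / ρ.total ξ

theorem translate_smooth (k : Fin n → ℤ) : ContDiff ℝ ∞ (ρ.translate k) :=
  ρ.smooth.comp (contDiff_id.sub contDiff_const)

theorem abs_le_of_translate_ne_zero {k : Fin n → ℤ} {ξ : Eu n} (h : ρ.translate k ξ ≠ 0)
    (i : Fin n) : |ξ i - k i| ≤ 1 := by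
  have := ρ.support_subset (subset_tsupport _ (Function.mem_support.2 h)) i
  simpa [latticePt] using this

theorem locallyFinite : LocallyFinite fun k => Function.support (ρ.translate k) := by
  intro ξ
  refine ⟨Metric.ball ξ 1, Metric.ball_mem_nhds _ one_pos, ?_⟩
  refine (Set.finite_Icc (fun i => ⌊ξ i⌋ - 2) (fun i => ⌊ξ i⌋ + 3)).subset ?_
  rintro k ⟨η, hη, hd⟩
  have key : ∀ i, |ξ i - k i| < 2 := by
    intro i
    have h1 := ρ.abs_le_of_translate_ne_zero (Function.mem_support.1 hη) i
    have h2 : |η i - ξ i| ≤ dist η ξ := by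
      rw [dist_eq_norm]
      simpa using PiLp.norm_apply_le (η - ξ) i
    have h3 : dist η ξ < 1 := hd
    rw [abs_le] at h1 h2
    rw [abs_lt]
    constructor <;> linarith [h1.1, h1.2, h2.1, h2.2]
  refine ⟨fun i => ?_, fun i => ?_⟩
  · have h1 := (abs_lt.1 (key i)).2
    have h2 := Int.floor_le (ξ i)
    have : (⌊ξ i⌋ : ℝ) - 2 < k i := by linarith
    have : ⌊ξ i⌋ - 2 < k i := by exact_mod_cast this
    exact this.le
  · have h1 := (abs_lt.1 (key i)).1
    have h2 := Int.lt_floor_add_one (ξ i)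
    have : (k i : ℝ) < ⌊ξ i⌋ + 3 := by linarith
    have : k i < ⌊ξ i⌋ + 3 := by exact_mod_cast this
    exact this.le

theorem total_smooth : ContDiff ℝ ∞ ρ.total := by
  rw [← contMDiff_iff_contDiff]
  exact contMDiff_finsum (fun k => (ρ.translate_smooth k).contMDiff) ρ.locallyFinite

theorem one_le_total (ξ : Eu n) : 1 ≤ ρ.total ξ := by
  have hfin : (Function.support fun k => ρ.translate k ξ).Finite := ρ.locallyFinite.point_finite ξ
  have h1 : ρ.translate (fun i => round (ξ i)) ξ = 1 := by
    refine ρ.eq_one _ fun i => ?_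
    simpa [latticePt] using abs_sub_round (ξ i)
  rw [← h1]
  exact single_le_finsum _ hfin fun k => (ρ.mem_Icc _).1

theorem sigma_smooth (k : Fin n → ℤ) : ContDiff ℝ ∞ (ρ.sigma k) :=
  (ρ.translate_smooth k).div ρ.total_smooth fun ξ =>
    (zero_lt_one.trans_le (ρ.one_le_total ξ)).ne'

theorem sigma_hasCompactSupport (k : Fin n → ℤ) : HasCompactSupport (ρ.sigma k) := by
  refine HasCompactSupport.intro (K := Metric.closedBall (latticePt k) (Real.sqrt n))
    (isCompact_closedBall _ _) fun ξ hξ => ?_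
  by_contra h
  refine hξ ?_
  have h0 : ρ.translate k ξ ≠ 0 := fun h0 => h (by simp [sigma, h0])
  have h1 := ρ.abs_le_of_translate_ne_zero h0
  rw [Metric.mem_closedBall, EuclideanSpace.dist_eq]
  refine Real.sqrt_le_sqrt ?_
  calc ∑ i, dist (ξ i) (latticePt k i) ^ 2 ≤ ∑ _i : Fin n, (1 : ℝ) := by
        refine Finset.sum_le_sum fun i _ => ?_
        have : dist (ξ i) (latticePt k i) ≤ 1 := h1 i
        exact pow_le_one₀ dist_nonneg this
    _ = n := by simp

/-- `σ_k` as a (complex-valued) Schwartz function. -/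
def sigmaS (k : Fin n → ℤ) : 𝓢(Eu n, ℂ) :=
  HasCompactSupport.toSchwartzMap (f := fun ξ => (ρ.sigma k ξ : ℂ))
    ((ρ.sigma_hasCompactSupport k).comp_left Complex.ofReal_zero)
    (Complex.ofRealCLM.contDiff.comp (ρ.sigma_smooth k))

theorem sigmaS_apply (k : Fin n → ℤ) (ξ : Eu n) : ρ.sigmaS k ξ = (ρ.sigma k ξ : ℂ) := rfl

/-- The frequency-uniform decomposition operator `□_k f = F⁻¹[σ_k F f]`. -/
def box (k : Fin n → ℤ) (f : 𝓢'(Eu n, ℂ)) : Eu n → ℂ := fourierMul (ρ.sigmaS k) f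

end Window

/-! ### Modulation spaces -/

/-- `⟨ξ⟩ = (1 + |ξ|²)^{1/2}`. -/
def bracket {n : ℕ} (ξ : Eu n) : ℝ := Real.sqrt (1 + ‖ξ‖ ^ 2)

/-- The norm `‖f‖_{M^s_{p,q}} = (∑_{k ∈ ℤⁿ} ⟨k⟩^{sq} ‖□_k f‖_{L_p}^q)^{1/q}` (a supremum over `k` if
`q = ∞`), with value `∞` if `f ∉ M^s_{p,q}`. It is written as an `L_q`-norm with respect to the
counting measure on `ℤⁿ`. -/
def modNorm {n : ℕ} (ρ : Window n) (p q : ℝ≥0∞) (s : ℝ) (f : 𝓢'(Eu n, ℂ)) : ℝ≥0∞ :=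
  eLpNorm (fun k : Fin n → ℤ =>
    ENNReal.ofReal (bracket (latticePt k) ^ s) * eLpNorm (ρ.box k f) p volume) q Measure.count

/-- The modulation space `M^s_{p,q}`. -/
def modSpace {n : ℕ} (ρ : Window n) (p q : ℝ≥0∞) (s : ℝ) : Set 𝓢'(Eu n, ℂ) :=
  {f | modNorm ρ p q s f < ⊤}

/-- The cube `P_R`. -/
def cube (n : ℕ) (R : ℝ) : Set (Eu n) := {ξ | ∀ j, |ξ j| ≤ R}

/-- `P_R(ε)`: the points of the open orthant with signs `(-1)^{ε_j}` that lie outside `P_R`. -/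
def orthantPiece {n : ℕ} (ε : Fin n → Fin 2) (R : ℝ) : Set (Eu n) :=
  {ξ | ∀ j, Real.sign (ξ j) = (-1) ^ (ε j : ℕ)} \ cube n R

/-- `M^s_{p,q}(ε, R)`: the elements `f` of `M^s_{p,q}` with `supp F f ⊆ P_R(ε)`. -/
def modSpaceOrthant {n : ℕ} (ρ : Window n) (p q : ℝ≥0∞) (s : ℝ) (ε : Fin n → Fin 2) (R : ℝ) :
    Set 𝓢'(Eu n, ℂ) :=
  {f ∈ modSpace ρ p q s | Distribution.dsupport (fourierD f) ⊆ orthantPiece ε R}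

/-! ### The product of tempered distributions -/

/-- `S^j f = F⁻¹[ψ(2^{-j} ·) F f]`. -/
def lowPass {n : ℕ} (ψ : 𝓢(Eu n, ℂ)) (j : ℕ) (f : 𝓢'(Eu n, ℂ)) : Eu n → ℂ :=
  fourierMul (dilate ((2 : ℝ) ^ j)⁻¹ (by positivity) ψ) f

/-- `h` is the product of `f` and `g`, that is, `h = lim_{j → ∞} S^j f · S^j g` in `𝓢'`
(pointwise on test functions), for every cut-off `ψ ∈ C_0^∞` that is `1` near the origin. -/
def IsProduct {n : ℕ} (f g h : 𝓢'(Eu n, ℂ)) : Prop :=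
  ∀ ψ : 𝓢(Eu n, ℂ), HasCompactSupport ψ → (∀ᶠ ξ in 𝓝 0, ψ ξ = 1) →
    ∀ φ : 𝓢(Eu n, ℂ),
      Tendsto (fun j : ℕ => ∫ x, lowPass ψ j f x * lowPass ψ j g x * φ x) atTop (𝓝 (h φ))

end

end ModulationSpaces

open ModulationSpaces

/-! Split `f` and `g` into unit frequency boxes. The product `□_k f · □_l g` has its spectrum at
bounded distance from `k + l`, and all indices `k`, `l` that occur lie in one closed orthant and
have a coordinate larger than `R - 1` in modulus. Inside one orthant nothing cancels, `|k i| + |l i|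
= |k i + l i|` (`abs_add_abs_of_mem_orthantLattice`), so `k + l` controls `k` and `l` separately.
This has two consequences.

Existence of the product. Tested against `F θ`, the term `(k, l)` sees only the part of `θ` near `k
+ l`, so it is bounded by a multiple of `(1 + |k + l|)^(-N)` for any chosen `N`
(`exists_enorm_integral_mul_le`). With `N = 2(n + 1)` this is summable over all pairs
(`inv_pow_le_pairWeight`). The same majorant holds after the cut-offs `ψ(2^(-j) ·)`, up to a factor
independent of `j`, and dominated convergence identifies the product with the double series
(`exists_product`).

The estimate. `□_m` of the product sees only pairs with `k + l - m` in a fixed finite set, so Young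
and Hölder bound its norm by finitely many discrete convolutions (`eLpNorm_box_le`). Put `t = s₁ +
s₂ - s₀`. For `|l| ≤ |k|` the bracket of `k + l` is comparable to that of `k`, and `s₀ ≤ s₁` gives
`⟨k⟩^s₀ ≤ ⟨k⟩^s₁ ⟨l⟩^s₂ ⟨l⟩^(-t)`; the other case is symmetric. Young's inequality `ℓ¹ * ℓ^q` and
Hölder then leave the `ℓ^q'` norm of `⟨l⟩^(-t)` outside the cube of size `R - 1`
(`eLpNorm_weight_mul_sum_le`), which is of order at most `(R - 2)^(-(t - n/q'))`
(`exists_eLpNorm_tailWeight_le`).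

The statements on spectra rest on `integral_fourierMul_mul_fourierMul_eq_zero`, and this on the fact
that a tempered distribution passes under a convolution integral (`apply_conv`). -/

namespace ModulationSpaces

noncomputable section

/-! ### Translation on Schwartz space: polynomial growth and continuity. -/

section Translation

variable {E F : Type*} [NormedAddCommGroup E] [NormedSpace ℝ E] [NormedAddCommGroup F]
  [NormedSpace ℝ F] [NormedSpace ℂ F]

theorem iteratedFDeriv_compSubConst (K : 𝓢(E, F)) (l : ℕ) (x y : E) :
    iteratedFDeriv ℝ l (compSubConstCLM ℂ x K) y = iteratedFDeriv ℝ l K (y - x) := by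
  have : ⇑(compSubConstCLM ℂ x K) = fun y => K (y - x) := rfl
  rw [this, iteratedFDeriv_comp_sub]

/-- The weight moves from `y` to the centred variable through `‖y‖ ≤ (1 + ‖y - x‖)(1 + ‖x‖)`, and
the Schwartz decay of `K` absorbs the first factor. -/
theorem norm_pow_mul_iteratedFDeriv_le (K : 𝓢(E, F)) (k l : ℕ) :
    ∃ C : ℝ, 0 ≤ C ∧ ∀ x y : E,
      ‖y‖ ^ k * ‖iteratedFDeriv ℝ l K (y - x)‖ ≤ C * (1 + ‖x‖) ^ k := by
  refine ⟨2 ^ k * (Finset.Iic (k, l)).sup (fun m => SchwartzMap.seminorm ℝ m.1 m.2) K,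
    by positivity, fun x y => ?_⟩
  have h := one_add_le_sup_seminorm_apply (𝕜 := ℝ) (m := (k, l)) le_rfl le_rfl K (y - x)
  have h1 : ‖y‖ ≤ (1 + ‖y - x‖) * (1 + ‖x‖) := by
    have : ‖y‖ ≤ ‖y - x‖ + ‖x‖ := by simpa using norm_add_le (y - x) x
    nlinarith [norm_nonneg (y - x), norm_nonneg x, mul_nonneg (norm_nonneg (y - x)) (norm_nonneg x)]
  calc ‖y‖ ^ k * ‖iteratedFDeriv ℝ l K (y - x)‖
      ≤ ((1 + ‖y - x‖) * (1 + ‖x‖)) ^ k * ‖iteratedFDeriv ℝ l K (y - x)‖ := by gcongr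
    _ = ((1 + ‖y - x‖) ^ k * ‖iteratedFDeriv ℝ l K (y - x)‖) * (1 + ‖x‖) ^ k := by
        rw [mul_pow]; ring
    _ ≤ _ := by gcongr

/-- The Schwartz seminorms of the translates of a Schwartz function grow at most polynomially. -/
theorem seminorm_compSubConst_le (K : 𝓢(E, F)) (k l : ℕ) :
    ∃ C : ℝ, 0 ≤ C ∧ ∀ x : E,
      SchwartzMap.seminorm ℂ k l (compSubConstCLM ℂ x K) ≤ C * (1 + ‖x‖) ^ k := by
  obtain ⟨C, hC, h⟩ := norm_pow_mul_iteratedFDeriv_le K k l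
  refine ⟨C, hC, fun x => seminorm_le_bound _ _ _ _ (by positivity) fun y => ?_⟩
  rw [iteratedFDeriv_compSubConst]
  exact h x y

/-- Translation is continuous on Schwartz space. -/
theorem continuous_compSubConst (K : 𝓢(E, F)) :
    Continuous fun x : E => compSubConstCLM ℂ x K := by
  rw [continuous_iff_continuousAt]
  intro x₀
  rw [ContinuousAt, (schwartz_withSeminorms ℂ E F).tendsto_nhds]
  rintro ⟨k, l⟩ ε hε
  obtain ⟨C, hC, h⟩ := norm_pow_mul_iteratedFDeriv_le K k (l + 1)
  set M : ℝ := C * (2 + ‖x₀‖) ^ k with hM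
  have hM0 : 0 ≤ M := by positivity
  have key : ∀ x ∈ Metric.ball x₀ 1,
      SchwartzMap.seminorm ℂ k l (compSubConstCLM ℂ x K - compSubConstCLM ℂ x₀ K)
        ≤ M * ‖x - x₀‖ := by
    intro x hx
    refine seminorm_le_bound _ _ _ _ (by positivity) fun y => ?_
    have e : iteratedFDeriv ℝ l (⇑(compSubConstCLM ℂ x K - compSubConstCLM ℂ x₀ K)) y
        = iteratedFDeriv ℝ l K (y - x) - iteratedFDeriv ℝ l K (y - x₀) := by
      have : ⇑(compSubConstCLM ℂ x K - compSubConstCLM ℂ x₀ K)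
          = ⇑(compSubConstCLM ℂ x K) - ⇑(compSubConstCLM ℂ x₀ K) := rfl
      rw [this, iteratedFDeriv_sub (SchwartzMap.smooth _ l) (SchwartzMap.smooth _ l),
        Pi.sub_apply, iteratedFDeriv_compSubConst, iteratedFDeriv_compSubConst]
    rw [e]
    have hd : Differentiable ℝ (iteratedFDeriv ℝ l K) :=
      (K.smooth ⊤).differentiable_iteratedFDeriv (mod_cast ENat.natCast_lt_top l)
    -- Mean value inequality between `y - x₀` and `y - x`, with the factor `‖y‖ ^ k` frozen. At `z`
    -- the derivative is estimated by `h` for the translate by `y - z`, whose norm is at most `1 +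
    -- ‖x₀‖`; hence the `2 + ‖x₀‖` in `M`.
    have hmv := Convex.norm_image_sub_le_of_norm_fderiv_le (𝕜 := ℝ)
      (f := fun z => ‖y‖ ^ k • iteratedFDeriv ℝ l K z) (C := M) (s := Metric.ball (y - x₀) 1)
      (x := y - x₀) (y := y - x) (fun z _ => (hd z).fun_const_smul _)
      (fun z hz => ?_) (convex_ball _ _) (Metric.mem_ball_self one_pos) ?_
    · rw [← smul_sub, norm_smul, norm_pow, norm_norm] at hmv
      refine hmv.trans_eq ?_
      rw [show y - x - (y - x₀) = -(x - x₀) by abel, norm_neg]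
    · rw [fderiv_fun_const_smul (hd z), norm_smul, norm_pow, norm_norm,
        norm_fderiv_iteratedFDeriv]
      have := h (y - z) y
      rw [sub_sub_cancel] at this
      refine this.trans ?_
      have h2 : ‖y - z‖ ≤ 1 + ‖x₀‖ := by
        have h3 : ‖z - (y - x₀)‖ < 1 := by simpa [dist_eq_norm] using hz
        have h4 : y - z = x₀ - (z - (y - x₀)) := by abel
        rw [h4]
        linarith [norm_sub_le x₀ (z - (y - x₀))]
      rw [hM]
      exact mul_le_mul_of_nonneg_left (pow_le_pow_left₀ (by positivity) (by linarith) k) hC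
    · rw [Metric.mem_ball, dist_eq_norm, show y - x - (y - x₀) = -(x - x₀) by abel, norm_neg,
        ← dist_eq_norm]
      exact hx
  have hlim : Tendsto (fun x => M * ‖x - x₀‖) (𝓝 x₀) (𝓝 0) := by
    have : Continuous fun x => M * ‖x - x₀‖ := by fun_prop
    simpa using this.tendsto x₀
  filter_upwards [Metric.ball_mem_nhds x₀ one_pos, hlim.eventually (gt_mem_nhds hε)] with x hx hx2
  exact (key x hx).trans_lt hx2

end Translation

/-! ### Tempered distributions as functionals bounded by finitely many seminorms. -/

section Functional

variable {E : Type*} [NormedAddCommGroup E] [NormedSpace ℝ E]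

/-- A tempered distribution is bounded by finitely many Schwartz seminorms. -/
theorem exists_bound (f : 𝓢'(E, ℂ)) : ∃ (s : Finset (ℕ × ℕ)) (C : ℝ), 0 ≤ C ∧
    ∀ φ : 𝓢(E, ℂ), ‖f φ‖ ≤ C * s.sup (schwartzSeminormFamily ℂ E ℂ) φ := by
  have hc : Continuous fun φ : 𝓢(E, ℂ) => f φ := map_continuous f
  obtain ⟨s, C, h⟩ := Seminorm.bound_of_continuous (schwartz_withSeminorms ℂ E ℂ)
    ((normSeminorm ℂ ℂ).comp (f : 𝓢(E, ℂ) →ₗ[ℂ] ℂ)) (continuous_norm.comp hc)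
  exact ⟨s, C, C.2, fun φ => h.2 φ⟩

/-- A finite supremum of Schwartz seminorms is bounded by the largest seminorm of the sum. -/
theorem sup_seminorm_le {s : Finset (ℕ × ℕ)} {φ : 𝓢(E, ℂ)} {M : ℝ} (hM : 0 ≤ M)
    (h : ∀ i ∈ s, SchwartzMap.seminorm ℂ i.1 i.2 φ ≤ M) :
    s.sup (schwartzSeminormFamily ℂ E ℂ) φ ≤ M :=
  Seminorm.finset_sup_apply_le hM h

/-- The target is left general because the bound serves both for a distribution and for the
embedding of Schwartz space into a Banach space in `apply_conv_of_factor`. -/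
theorem norm_map_compSubConst_le {B : Type*} [SeminormedAddCommGroup B] (A : 𝓢(E, ℂ) → B)
    {s : Finset (ℕ × ℕ)} {C : ℝ} (hC : 0 ≤ C)
    (hf : ∀ φ, ‖A φ‖ ≤ C * s.sup (schwartzSeminormFamily ℂ E ℂ) φ) (K : 𝓢(E, ℂ)) :
    ∃ (N : ℕ) (C : ℝ), 0 ≤ C ∧ ∀ x : E, ‖A (compSubConstCLM ℂ x K)‖ ≤ C * (1 + ‖x‖) ^ N := by
  choose A hA h using fun i : ℕ × ℕ => seminorm_compSubConst_le K i.1 i.2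
  refine ⟨s.sup Prod.fst, C * ∑ i ∈ s, A i,
    mul_nonneg hC (Finset.sum_nonneg fun i _ => hA i), fun x => ?_⟩
  refine (hf _).trans ?_
  rw [mul_assoc]
  refine mul_le_mul_of_nonneg_left (sup_seminorm_le ?_ fun i hi => ?_) hC
  · have := Finset.sum_nonneg fun i (_ : i ∈ s) => hA i
    positivity
  · refine (h i x).trans ?_
    have h1 : A i ≤ ∑ i ∈ s, A i := Finset.single_le_sum (fun i _ => hA i) hi
    have h2 : (1 + ‖x‖) ^ i.1 ≤ (1 + ‖x‖) ^ s.sup Prod.fst :=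
      pow_le_pow_right₀ (by linarith [norm_nonneg x]) (Finset.le_sup (f := Prod.fst) hi)
    exact mul_le_mul h1 h2 (by positivity) ((hA i).trans h1)

/-- `x ↦ f(φ(· - x))` has polynomial growth. -/
theorem norm_apply_compSubConst_le (f : 𝓢'(E, ℂ)) (K : 𝓢(E, ℂ)) :
    ∃ (N : ℕ) (C : ℝ), 0 ≤ C ∧ ∀ x : E, ‖f (compSubConstCLM ℂ x K)‖ ≤ C * (1 + ‖x‖) ^ N := by
  obtain ⟨s, C, hC, hf⟩ := exists_bound f
  exact norm_map_compSubConst_le (fun φ => f φ) hC hf K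

theorem continuous_apply_compSubConst (f : 𝓢'(E, ℂ)) (K : 𝓢(E, ℂ)) :
    Continuous fun x : E => f (compSubConstCLM ℂ x K) :=
  (map_continuous f).comp (continuous_compSubConst K)

/-- The product of two Schwartz functions. -/
abbrev mulS (a b : 𝓢(E, ℂ)) : 𝓢(E, ℂ) := smulLeftCLM ℂ a b

theorem mulS_apply (a b : 𝓢(E, ℂ)) (x : E) : mulS a b x = a x * b x := by
  rw [mulS, smulLeftCLM_apply_apply a.hasTemperateGrowth, smul_eq_mul]

/-- Cutting off a Schwartz function near a point `a` yields rapid decay in `a`. -/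
theorem seminorm_mulS_compSubConst_le (χ : 𝓢(E, ℂ)) (N k l : ℕ) :
    ∃ C : ℝ, 0 ≤ C ∧ ∀ (a : E) (θ : 𝓢(E, ℂ)),
      (1 + ‖a‖) ^ N * SchwartzMap.seminorm ℂ k l (mulS (compSubConstCLM ℂ a χ) θ)
        ≤ C * (Finset.Iic (k + N, l)).sup (schwartzSeminormFamily ℂ E ℂ) θ := by
  set A : ℝ := 2 ^ N * (Finset.Iic (N, l)).sup (fun m => SchwartzMap.seminorm ℂ m.1 m.2) χ with hA
  have hA0 : 0 ≤ A := by positivity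
  refine ⟨2 ^ l * (A * 2 ^ (k + N)), by positivity, fun a θ => ?_⟩
  set T : ℝ := (Finset.Iic (k + N, l)).sup (schwartzSeminormFamily ℂ E ℂ) θ with hT
  have hT0 : 0 ≤ T := apply_nonneg _ _
  have ha : 0 < (1 + ‖a‖) ^ N := by positivity
  rw [mul_comm, ← le_div_iff₀ ha]
  refine seminorm_le_bound _ _ _ _ (by positivity) fun x => ?_
  rw [le_div_iff₀ ha]
  have e : ⇑(mulS (compSubConstCLM ℂ a χ) θ) = fun x => compSubConstCLM ℂ a χ x * θ x :=
    funext fun x => mulS_apply _ _ _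
  have h1 := norm_iteratedFDeriv_mul_le (𝕜 := ℝ) (n := l) (N := l)
    ((compSubConstCLM ℂ a χ).smooth l) (θ.smooth l) x le_rfl
  rw [← e] at h1
  -- Peetre's inequality distributes `(1 + ‖a‖) ^ N`: the decay of `χ` about `a` pays for one factor
  -- and `N` extra weights on `θ` pay for the other.
  have h2 : (1 + ‖a‖) ≤ (1 + ‖x - a‖) * (1 + ‖x‖) := by
    have h3 : ‖a‖ ≤ ‖x - a‖ + ‖x‖ := by
      have := norm_sub_le x (x - a)
      rw [sub_sub_cancel] at this
      linarith
    nlinarith [mul_nonneg (norm_nonneg (x - a)) (norm_nonneg x)]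
  have h4 : ∀ i ∈ Finset.range (l + 1),
      ‖x‖ ^ k * ((l.choose i : ℝ) * ‖iteratedFDeriv ℝ i (compSubConstCLM ℂ a χ) x‖ *
        ‖iteratedFDeriv ℝ (l - i) θ x‖) * (1 + ‖a‖) ^ N
      ≤ (l.choose i : ℝ) * (A * (2 ^ (k + N) * T)) := by
    intro i hi
    rw [iteratedFDeriv_compSubConst]
    have h5 := one_add_le_sup_seminorm_apply (𝕜 := ℂ) (m := (N, l)) (k := N) (n := i) le_rfl
      (Finset.mem_range_succ_iff.1 hi) χ (x - a)
    have h6 := one_add_le_sup_seminorm_apply (𝕜 := ℂ) (m := (k + N, l)) (k := k + N) (n := l - i)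
      le_rfl (Nat.sub_le _ _) θ x
    calc ‖x‖ ^ k * ((l.choose i : ℝ) * ‖iteratedFDeriv ℝ i χ (x - a)‖ *
          ‖iteratedFDeriv ℝ (l - i) θ x‖) * (1 + ‖a‖) ^ N
        ≤ (1 + ‖x‖) ^ k * ((l.choose i : ℝ) * ‖iteratedFDeriv ℝ i χ (x - a)‖ *
          ‖iteratedFDeriv ℝ (l - i) θ x‖) * ((1 + ‖x - a‖) * (1 + ‖x‖)) ^ N := by
          gcongr
          linarith
      _ = (l.choose i : ℝ) * (((1 + ‖x - a‖) ^ N * ‖iteratedFDeriv ℝ i χ (x - a)‖) *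
          ((1 + ‖x‖) ^ (k + N) * ‖iteratedFDeriv ℝ (l - i) θ x‖)) := by
          rw [mul_pow, pow_add]; ring
      _ ≤ _ := by
          refine mul_le_mul_of_nonneg_left (mul_le_mul h5 h6 (by positivity) hA0) (by positivity)
  calc ‖x‖ ^ k * ‖iteratedFDeriv ℝ l (⇑(mulS (compSubConstCLM ℂ a χ) θ)) x‖ * (1 + ‖a‖) ^ N
      ≤ ‖x‖ ^ k * (∑ i ∈ Finset.range (l + 1), (l.choose i : ℝ) *
          ‖iteratedFDeriv ℝ i (compSubConstCLM ℂ a χ) x‖ * ‖iteratedFDeriv ℝ (l - i) θ x‖)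
          * (1 + ‖a‖) ^ N := by gcongr
    _ = ∑ i ∈ Finset.range (l + 1), ‖x‖ ^ k * ((l.choose i : ℝ) *
          ‖iteratedFDeriv ℝ i (compSubConstCLM ℂ a χ) x‖ * ‖iteratedFDeriv ℝ (l - i) θ x‖)
          * (1 + ‖a‖) ^ N := by rw [Finset.mul_sum, Finset.sum_mul]
    _ ≤ ∑ i ∈ Finset.range (l + 1), (l.choose i : ℝ) * (A * (2 ^ (k + N) * T)) :=
        Finset.sum_le_sum h4
    _ = _ := by
        rw [← Finset.sum_mul, ← Nat.cast_sum, Nat.sum_range_choose]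
        push_cast
        ring

/-- The map `φ ↦ ‖·‖^k D^l φ` into the bounded continuous functions. -/
def weightedDeriv (k l : ℕ) :
    𝓢(E, ℂ) →L[ℂ] BoundedContinuousFunction E (E [×l]→L[ℝ] ℂ) :=
  mkCLMtoNormedSpace (σ := RingHom.id ℂ) (G := BoundedContinuousFunction E (E [×l]→L[ℝ] ℂ))
    (fun φ => BoundedContinuousFunction.ofNormedAddCommGroup
      (fun y => ‖y‖ ^ k • iteratedFDeriv ℝ l φ y)
      ((continuous_norm.pow k).smul ((φ.smooth l).continuous_iteratedFDeriv le_rfl))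
      (SchwartzMap.seminorm ℂ k l φ)
      (fun y => by
        rw [norm_smul, norm_pow, norm_norm]
        exact le_seminorm ℂ k l φ y))
    (fun φ ψ => by
      ext1 y
      have : ⇑(φ + ψ) = ⇑φ + ⇑ψ := rfl
      simp [this, iteratedFDeriv_add (SchwartzMap.smooth φ l) (SchwartzMap.smooth ψ l)])
    (fun a φ => by
      ext1 y
      have : ⇑(a • φ) = a • ⇑φ := rfl
      simp only [BoundedContinuousFunction.coe_ofNormedAddCommGroup, this, RingHom.id_apply,
        BoundedContinuousFunction.coe_smul]
      rw [iteratedFDeriv_const_smul_apply ((SchwartzMap.smooth φ _).contDiffAt), smul_comm])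
    (by
      refine ⟨{(k, l)}, 1, zero_le_one, fun φ => ?_⟩
      rw [one_mul, Finset.sup_singleton]
      exact BoundedContinuousFunction.norm_ofNormedAddCommGroup_le _ (apply_nonneg _ _) _)

theorem weightedDeriv_apply (k l : ℕ) (φ : 𝓢(E, ℂ)) (y : E) :
    weightedDeriv k l φ y = ‖y‖ ^ k • iteratedFDeriv ℝ l φ y := rfl

theorem seminorm_le_norm_weightedDeriv (k l : ℕ) (φ : 𝓢(E, ℂ)) :
    SchwartzMap.seminorm ℂ k l φ ≤ ‖weightedDeriv k l φ‖ := by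
  refine seminorm_le_bound _ _ _ _ (norm_nonneg (weightedDeriv k l φ)) fun y => ?_
  have := (weightedDeriv k l φ).norm_coe_le_norm y
  rwa [weightedDeriv_apply, norm_smul, norm_pow, norm_norm] at this

theorem norm_weightedDeriv_le (k l : ℕ) (φ : 𝓢(E, ℂ)) :
    ‖weightedDeriv k l φ‖ ≤ SchwartzMap.seminorm ℂ k l φ := by
  refine (BoundedContinuousFunction.norm_le (apply_nonneg _ _)).2 fun y => ?_
  rw [weightedDeriv_apply, norm_smul, norm_pow, norm_norm]
  exact le_seminorm ℂ k l φ y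

/-- The joint map `φ ↦ (‖·‖^k D^l φ)_{(k,l) ∈ s}`. -/
def weightedDerivs (s : Finset (ℕ × ℕ)) :
    𝓢(E, ℂ) →L[ℂ] ((i : s) → BoundedContinuousFunction E (E [×i.1.2]→L[ℝ] ℂ)) :=
  ContinuousLinearMap.pi fun i => weightedDeriv i.1.1 i.1.2

/-- A linear functional that is bounded with respect to a linear map into a normed space factors
through a continuous linear functional on the latter. -/
theorem exists_factor {V B : Type*} [AddCommGroup V] [Module ℂ V] [NormedAddCommGroup B]
    [NormedSpace ℂ B] (ι : V →ₗ[ℂ] B) (f : V →ₗ[ℂ] ℂ) (C : ℝ) (h : ∀ v, ‖f v‖ ≤ C * ‖ι v‖) :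
    ∃ g : B →L[ℂ] ℂ, ∀ v, g (ι v) = f v := by
  have hker : LinearMap.ker ι ≤ LinearMap.ker f := by
    intro v hv
    rw [LinearMap.mem_ker] at hv ⊢
    have := h v
    rw [hv, norm_zero, mul_zero] at this
    exact norm_le_zero_iff.1 this
  let g₀ : LinearMap.range ι →ₗ[ℂ] ℂ :=
    (LinearMap.ker ι).liftQ f hker ∘ₗ ι.quotKerEquivRange.symm.toLinearMap
  have hg₀ : ∀ v, g₀ ⟨ι v, LinearMap.mem_range_self ι v⟩ = f v := by
    intro v
    have : ι.quotKerEquivRange.symm ⟨ι v, LinearMap.mem_range_self ι v⟩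
        = (LinearMap.ker ι).mkQ v := by
      rw [LinearEquiv.symm_apply_eq]
      rfl
    simp [g₀, this]
  obtain ⟨g, hg, -⟩ := exists_extension_norm_eq (LinearMap.range ι)
    (g₀.mkContinuous C (by
      rintro ⟨_, v, rfl⟩
      rw [hg₀]
      exact h v))
  exact ⟨g, fun v => by
    have := hg ⟨ι v, LinearMap.mem_range_self ι v⟩
    simpa [hg₀] using this⟩

end Functional

/-! ### Exchanging a distribution with a convolution integral. -/

section Interchange

variable {E : Type*} [NormedAddCommGroup E] [InnerProductSpace ℝ E] [FiniteDimensional ℝ E]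
  [MeasurableSpace E] [BorelSpace E]

/-- The convolution `y ↦ ∫ φ(x) K(y - x) dx` of Schwartz functions. -/
abbrev conv (φ K : 𝓢(E, ℂ)) : 𝓢(E, ℂ) := convolution (ContinuousLinearMap.mul ℂ ℂ) φ K

theorem conv_apply (φ K : 𝓢(E, ℂ)) (y : E) : conv φ K y = ∫ x, φ x * K (y - x) := by
  rw [conv, convolution_apply, MeasureTheory.convolution]
  rfl

open LineDeriv

/-- On the Fourier side convolution is a product and the derivative a multiplication by a linear
function, which may be attached to either factor. -/
theorem lineDeriv_conv (φ K : 𝓢(E, ℂ)) (v : E) : ∂_{v} (conv φ K) = conv φ (∂_{v} K) := by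
  have hinj : Function.Injective (fun ψ : 𝓢(E, ℂ) => 𝓕 ψ) := fun a b hab => by
    simpa using congrArg (fun ψ : 𝓢(E, ℂ) => 𝓕⁻ ψ) hab
  apply hinj
  have hg : (fun x : E => inner ℝ x v).HasTemperateGrowth := by fun_prop
  ext ξ
  simp only [fourier_lineDerivOp_eq, fourier_convolution, smul_apply,
    smulLeftCLM_apply_apply hg, pairing_apply_apply, ContinuousLinearMap.mul_apply']
  simp only [Complex.real_smul, smul_eq_mul]
  ring

theorem iteratedLineDeriv_conv (φ K : 𝓢(E, ℂ)) {l : ℕ} (v : Fin l → E) :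
    ∂^{v} (conv φ K) = conv φ (∂^{v} K) := by
  induction l with
  | zero => simp
  | succ l ih =>
    rw [iteratedLineDerivOp_succ_left, iteratedLineDerivOp_succ_left, ih, lineDeriv_conv]

theorem integrable_smul_of_polynomial_growth {B : Type*} [NormedAddCommGroup B] [NormedSpace ℂ B]
    {w : E → B} (hw : Continuous w) {N : ℕ} {C : ℝ} (hb : ∀ x, ‖w x‖ ≤ C * (1 + ‖x‖) ^ N)
    (φ : 𝓢(E, ℂ)) : Integrable fun x => φ x • w x := by
  have h0 : Integrable fun x : E => C * ((1 + ‖x‖) ^ N * ‖φ x‖) := by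
    have : ∀ x : E, (1 + ‖x‖) ^ N * ‖φ x‖
        = ∑ i ∈ Finset.range (N + 1), (N.choose i : ℝ) * (‖x‖ ^ i * ‖φ x‖) := by
      intro x
      rw [add_comm, add_pow, Finset.sum_mul]
      exact Finset.sum_congr rfl fun i _ => by simp; ring
    simp_rw [this]
    exact (integrable_finsetSum _ fun i _ => (φ.integrable_pow_mul volume i).const_mul _).const_mul C
  refine h0.mono' ((φ.continuous.smul hw).aestronglyMeasurable) (ae_of_all _ fun x => ?_)
  rw [norm_smul]
  calc ‖φ x‖ * ‖w x‖ ≤ ‖φ x‖ * (C * (1 + ‖x‖) ^ N) := by gcongr; exact hb x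
    _ = _ := by ring

/-- The Bochner integral is taken not in Schwartz space, which is not normed, but in a Banach space
`B` through which `f` factors. The functionals in `S` separate points and identify the integral with
`ι (conv φ K)`; the Hahn–Banach extension of `f` to `B` then passes under the integral sign. -/
theorem apply_conv_of_factor {B : Type*} [NormedAddCommGroup B] [NormedSpace ℂ B] [CompleteSpace B]
    (ι : 𝓢(E, ℂ) →ₗ[ℂ] B) {s : Finset (ℕ × ℕ)} {C : ℝ} (hC : 0 ≤ C)
    (hι : ∀ φ, ‖ι φ‖ ≤ C * s.sup (schwartzSeminormFamily ℂ E ℂ) φ)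
    (S : Set (B →ₗ[ℝ] ℂ)) (hS : ∀ e ∈ S, ∀ b, ‖e b‖ ≤ 1 * ‖b‖)
    (hsep : ∀ b b', (∀ e ∈ S, e b = e b') → b = b') (φ K : 𝓢(E, ℂ))
    (he : ∀ e ∈ S, e (ι (conv φ K)) = ∫ x, e (φ x • ι (compSubConstCLM ℂ x K)))
    (f : 𝓢(E, ℂ) →ₗ[ℂ] ℂ) {A : ℝ} (hf : ∀ φ, ‖f φ‖ ≤ A * ‖ι φ‖) :
    f (conv φ K) = ∫ x, φ x * f (compSubConstCLM ℂ x K) := by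
  obtain ⟨g, hg⟩ := exists_factor ι f A hf
  let ι' : 𝓢(E, ℂ) →L[ℂ] B := mkCLMtoNormedSpace (σ := RingHom.id ℂ) ι (map_add ι) (map_smul ι)
    ⟨s, C, hC, hι⟩
  set w : E → B := fun x => ι (compSubConstCLM ℂ x K) with hw
  have hwc : Continuous w := ι'.continuous.comp (continuous_compSubConst K)
  obtain ⟨N, D, -, hwb⟩ := norm_map_compSubConst_le ι hC hι K
  have hint : Integrable fun x => φ x • w x := integrable_smul_of_polynomial_growth hwc hwb φ
  have hI : ∫ x, φ x • w x = ι (conv φ K) := by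
    refine hsep _ _ fun e heS => ?_
    rw [he e heS]
    exact ((e.mkContinuous 1 (hS e heS)).integral_comp_comm hint).symm
  rw [← hg, ← hI, ← g.integral_comp_comm hint]
  refine integral_congr_ae (ae_of_all _ fun x => ?_)
  simp only [map_smul, smul_eq_mul, hw, hg]

/-- A tempered distribution commutes with the convolution integral. -/
theorem apply_conv (f : 𝓢'(E, ℂ)) (φ K : 𝓢(E, ℂ)) :
    f (conv φ K) = ∫ x, φ x * f (compSubConstCLM ℂ x K) := by
  obtain ⟨s, C, hC, hf⟩ := exists_bound f
  let ev (i : s) (y : E) (v : {v : Fin i.1.2 → E // ∀ j, ‖v j‖ ≤ 1}) :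
      ((i : s) → BoundedContinuousFunction E (E [×i.1.2]→L[ℝ] ℂ)) →ₗ[ℝ] ℂ :=
    { toFun := fun b => b i y v
      map_add' := fun _ _ => rfl
      map_smul' := fun _ _ => rfl }
  -- `B` is the finite product of the spaces of bounded continuous functions that receive the
  -- weighted derivatives, and `S` consists of point evaluations on vectors of the unit ball. For
  -- these the identity reduces to the pointwise formula for the convolution with a derivative of
  -- `K`.
  refine apply_conv_of_factor (B := (i : s) → BoundedContinuousFunction E (E [×i.1.2]→L[ℝ] ℂ))
    (weightedDerivs s).toLinearMap (s := s) zero_le_one (fun φ => ?_)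
    {e | ∃ i y v, e = ev i y v} ?_ ?_ φ K ?_ (f : 𝓢(E, ℂ) →ₗ[ℂ] ℂ) (A := C) (fun φ => ?_)
  · rw [one_mul]
    refine (pi_norm_le_iff_of_nonneg (apply_nonneg _ _)).2 fun i => ?_
    refine (norm_weightedDeriv_le i.1.1 i.1.2 φ).trans ?_
    exact Seminorm.le_finset_sup_apply (p := schwartzSeminormFamily ℂ E ℂ) i.2
  · rintro _ ⟨i, y, v, rfl⟩ b
    rw [one_mul]
    refine le_trans ?_ (norm_le_pi_norm b i)
    refine le_trans ?_ ((b i).norm_coe_le_norm y)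
    refine ((b i y).le_opNorm v).trans ?_
    exact mul_le_of_le_one_right (norm_nonneg _)
      (Finset.prod_le_one (fun _ _ => norm_nonneg _) fun j _ => v.2 j)
  · intro b b' h
    funext i
    ext y v
    -- An arbitrary `v` is rescaled into the unit ball; multilinearity then lets the nonzero scalar
    -- be cancelled.
    have hpos : ∀ j, 0 < 1 + ‖v j‖ := fun j => by positivity
    have h1 := h _ ⟨i, y, ⟨fun j => (1 + ‖v j‖)⁻¹ • v j, fun j => by
      rw [norm_smul, norm_inv, Real.norm_of_nonneg (hpos j).le, inv_mul_le_one₀ (hpos j)]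
      linarith⟩, rfl⟩
    have h2 : b i y (fun j => (1 + ‖v j‖)⁻¹ • v j) = b' i y (fun j => (1 + ‖v j‖)⁻¹ • v j) := h1
    rw [ContinuousMultilinearMap.map_smul_univ, ContinuousMultilinearMap.map_smul_univ] at h2
    exact smul_right_injective ℂ (Finset.prod_pos fun j _ => inv_pos.2 (hpos j)).ne' h2
  · rintro _ ⟨i, y, v, rfl⟩
    have h2 : ∀ x, ev i y v (φ x • weightedDerivs s (compSubConstCLM ℂ x K))
        = ‖y‖ ^ i.1.1 • (φ x * (∂^{v.1} K) (y - x)) := by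
      intro x
      have : ev i y v (φ x • weightedDerivs s (compSubConstCLM ℂ x K))
          = φ x • (‖y‖ ^ i.1.1 • iteratedFDeriv ℝ i.1.2 (compSubConstCLM ℂ x K) y v) := rfl
      rw [this, iteratedFDeriv_compSubConst, ← iteratedLineDerivOp_eq_iteratedFDeriv, smul_comm,
        smul_eq_mul]
    have h3 : ev i y v (weightedDerivs s (conv φ K))
        = ‖y‖ ^ i.1.1 • iteratedFDeriv ℝ i.1.2 (conv φ K) y v := rfl
    change ev i y v (weightedDerivs s (conv φ K))
      = ∫ x, ev i y v (φ x • weightedDerivs s (compSubConstCLM ℂ x K))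
    rw [h3, ← iteratedLineDerivOp_eq_iteratedFDeriv, iteratedLineDeriv_conv, conv_apply]
    simp_rw [h2]
    rw [integral_smul]
  · refine (hf φ).trans (mul_le_mul_of_nonneg_left
      (sup_seminorm_le (norm_nonneg (weightedDerivs s φ)) ?_) hC)
    intro i hi
    exact (seminorm_le_norm_weightedDeriv i.1 i.2 φ).trans
      (norm_le_pi_norm (weightedDerivs s φ) ⟨i, hi⟩)

end Interchange

/-! ### The normalized Fourier transform, multipliers, and the spectrum of a product. -/

variable {n : ℕ}

theorem normFactor_pos (n : ℕ) : 0 < normFactor n := Real.rpow_pos_of_pos Real.two_pi_pos _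

theorem normFactor_sq (n : ℕ) : normFactor n * normFactor n * (2 * Real.pi) ^ n = 1 := by
  rw [normFactor, ← Real.rpow_add Real.two_pi_pos, ← Real.rpow_natCast,
    ← Real.rpow_add Real.two_pi_pos]
  rw [show -(n : ℝ) / 2 + -n / 2 + n = 0 by ring, Real.rpow_zero]

theorem fourier_dilate (a : ℝ) (ha : a ≠ 0) (g : 𝓢(Eu n, ℂ)) :
    𝓕 (dilate a ha g) = ((|a| ^ n)⁻¹ : ℝ) • dilate a⁻¹ (inv_ne_zero ha) (𝓕 g) := by
  ext ξ
  rw [smul_apply, dilate_apply, fourier_coe, fourier_coe, Real.fourier_eq', Real.fourier_eq']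
  have h := Measure.integral_comp_smul (volume : Measure (Eu n))
    (fun x : Eu n => Complex.exp (↑(-2 * Real.pi * inner ℝ x (a⁻¹ • ξ)) * Complex.I) • g x) a
  rw [finrank_euclideanSpace_fin, abs_inv, abs_pow] at h
  rw [← h]
  refine integral_congr_ae (ae_of_all _ fun x => ?_)
  simp only [dilate_apply, inner_smul_left, inner_smul_right]
  congr 4
  simp
  field_simp

/-- The inverse of `fourierS`. -/
def fourierSInv (n : ℕ) : 𝓢(Eu n, ℂ) →L[ℂ] 𝓢(Eu n, ℂ) :=
  ((normFactor n)⁻¹ : ℂ) • (fourierCLM ℂ 𝓢(Eu n, ℂ) ∘L dilate (2 * Real.pi) Real.two_pi_pos.ne')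

theorem fourierSInv_eq (φ : 𝓢(Eu n, ℂ)) :
    fourierSInv n φ = ((normFactor n)⁻¹ : ℂ) • 𝓕 (dilate (2 * Real.pi) Real.two_pi_pos.ne' φ) := rfl

theorem fourierS_eq (φ : 𝓢(Eu n, ℂ)) :
    fourierS n φ = (normFactor n : ℂ) • dilate (2 * Real.pi)⁻¹ inv_two_pi_ne_zero (𝓕⁻ φ) := rfl

theorem normFactor_ne_zero (n : ℕ) : (normFactor n : ℂ) ≠ 0 := by
  exact_mod_cast (normFactor_pos n).ne'

theorem fourierS_fourierSInv (φ : 𝓢(Eu n, ℂ)) : fourierS n (fourierSInv n φ) = φ := by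
  rw [fourierS_eq, fourierSInv_eq, FourierTransform.fourierInv_smul, FourierTransform.fourierInv_fourier_eq, map_smul, smul_smul,
    mul_inv_cancel₀ (normFactor_ne_zero n), one_smul]
  ext x
  rw [dilate_apply, dilate_apply, smul_smul, mul_inv_cancel₀ Real.two_pi_pos.ne', one_smul]

/-- `F⁻¹ φ = (F φ)(-·)`. -/
theorem fourierSInv_apply_eq (φ : 𝓢(Eu n, ℂ)) (η : Eu n) :
    fourierSInv n φ η = fourierS n φ (-η) := by
  rw [fourierSInv_eq, fourier_dilate, fourierS_eq]
  simp only [smul_apply, dilate_apply]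
  have e : (𝓕⁻ φ) ((2 * Real.pi)⁻¹ • -η) = (𝓕 φ) ((2 * Real.pi)⁻¹ • η) := by
    rw [fourierInv_coe, fourier_coe, smul_neg, Real.fourierInv_eq_fourier_neg, neg_neg]
  rw [e, Complex.real_smul, smul_eq_mul, smul_eq_mul, ← mul_assoc]
  congr 1
  have h := normFactor_sq n
  have h0 := (normFactor_pos n).ne'
  have hpi : (2 * Real.pi) ^ n ≠ 0 := (pow_pos Real.two_pi_pos n).ne'
  rw [abs_of_pos Real.two_pi_pos]
  have : (normFactor n)⁻¹ * ((2 * Real.pi) ^ n)⁻¹ = normFactor n := by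
    field_simp
    linarith
  exact_mod_cast this

/-- The convolution theorem: `(2π)^{-n/2} F θ * F m = F (m θ)`. -/
theorem conv_fourierS (θ m : 𝓢(Eu n, ℂ)) :
    (normFactor n : ℂ) • conv (fourierS n θ) (fourierS n m) = fourierS n (mulS m θ) := by
  have hinj : Function.Injective (fun ψ : 𝓢(Eu n, ℂ) => 𝓕 ψ) := fun a b hab => by
    simpa using congrArg (fun ψ : 𝓢(Eu n, ℂ) => 𝓕⁻ ψ) hab
  apply hinj
  -- The standard transform `𝓕` undoes `fourierS` up to a dilation and a constant, so after applying
  -- it both sides are pointwise products.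
  have hF : ∀ ψ : 𝓢(Eu n, ℂ), 𝓕 (fourierS n ψ) = (normFactor n : ℂ) • (((2 * Real.pi) ^ n : ℝ) •
      dilate (2 * Real.pi) Real.two_pi_pos.ne' ψ) := by
    intro ψ
    rw [fourierS_eq, FourierTransform.fourier_smul, fourier_dilate, FourierTransform.fourier_fourierInv_eq]
    congr 2
    · rw [abs_inv, abs_of_pos Real.two_pi_pos, inv_pow, inv_inv]
    · ext x
      simp [dilate_apply]
  simp only [FourierTransform.fourier_smul]
  rw [fourier_convolution, hF, hF, hF]
  ext ξ
  simp only [smul_apply, pairing_apply_apply, ContinuousLinearMap.mul_apply', dilate_apply,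
    mulS_apply, Complex.real_smul, smul_eq_mul]
  have h : (normFactor n : ℂ) * normFactor n * ((2 * Real.pi) ^ n : ℝ) = 1 := by
    exact_mod_cast normFactor_sq n
  linear_combination (normFactor n * ((2 * Real.pi) ^ n : ℝ) *
    θ ((2 * Real.pi) • ξ) * m ((2 * Real.pi) • ξ)) * h

theorem compSubConst_fourierS (m : 𝓢(Eu n, ℂ)) (x : Eu n) :
    compSubConstCLM ℂ x (fourierS n m) = fourierS n (smulLeftCLM ℂ (character x) m) := by
  ext y
  rw [compSubConstCLM_apply, fourierS_apply, fourierS_apply]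
  congr 1
  refine integral_congr_ae (ae_of_all _ fun t => ?_)
  simp only [smulLeftCLM_apply_apply (character_hasTemperateGrowth x), smul_eq_mul, character]
  rw [← mul_assoc, ← Complex.exp_add, inner_sub_right, real_inner_comm x t]
  congr 2
  push_cast
  ring

theorem fourierS_compSubConst (m : 𝓢(Eu n, ℂ)) (η x : Eu n) :
    fourierS n (compSubConstCLM ℂ η m) x
      = Complex.exp (Complex.I * (inner ℝ x η : ℝ)) * fourierS n m x := by
  rw [fourierS_apply, fourierS_apply,
    ← integral_add_right_eq_self (fun t : Eu n => Complex.exp (Complex.I * (inner ℝ t x : ℝ)) *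
      compSubConstCLM ℂ η m t) η, mul_left_comm]
  congr 1
  rw [← integral_const_mul]
  refine integral_congr_ae (ae_of_all _ fun t => ?_)
  simp only [compSubConstCLM_apply, add_sub_cancel_right]
  rw [← mul_assoc, ← Complex.exp_add, inner_add_left, real_inner_comm x η]
  congr 2
  push_cast
  ring

/-- The function `F⁻¹[m F f]` represents the distribution `F⁻¹[m F f]`. -/
theorem integral_fourierMul_mul (m θ : 𝓢(Eu n, ℂ)) (f : 𝓢'(Eu n, ℂ)) :
    ∫ x, fourierMul m f x * fourierS n θ x = fourierD f (mulS m θ) := by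
  -- `F (m θ)` is a superposition of translates of `F m`; evaluating `f` on each translate gives the
  -- values of `fourierMul m f`.
  rw [fourierD_apply, ← conv_fourierS, map_smul, apply_conv, smul_eq_mul, ← integral_const_mul]
  refine integral_congr_ae (ae_of_all _ fun x => ?_)
  simp only [fourierMul_eq]
  ring

theorem character_smul_mulS (x : Eu n) (a b : 𝓢(Eu n, ℂ)) :
    smulLeftCLM ℂ (character x) (mulS a b) = mulS a (smulLeftCLM ℂ (character x) b) := by
  ext ξ
  simp only [mulS_apply, smulLeftCLM_apply_apply (character_hasTemperateGrowth x), smul_eq_mul]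
  ring

/-- `F⁻¹[m m' F f]` is a convolution of `F⁻¹[m F f]`. -/
theorem fourierMul_mulS (m m' : 𝓢(Eu n, ℂ)) (f : 𝓢'(Eu n, ℂ)) (x : Eu n) :
    fourierMul (mulS m m') f x
      = (normFactor n : ℂ) * ∫ y, fourierMul m f y * fourierS n m' (y - x) := by
  rw [fourierMul, character_smul_mulS, ← integral_fourierMul_mul, ← compSubConst_fourierS]
  rfl

theorem continuous_fourierMul (m : 𝓢(Eu n, ℂ)) (f : 𝓢'(Eu n, ℂ)) :
    Continuous (fourierMul m f) := by
  have : fourierMul m f = fun x => (normFactor n : ℂ) * f (compSubConstCLM ℂ x (fourierS n m)) :=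
    funext fun x => fourierMul_eq m f x
  rw [this]
  exact continuous_const.mul (continuous_apply_compSubConst f _)

theorem norm_fourierMul_le (m : 𝓢(Eu n, ℂ)) (f : 𝓢'(Eu n, ℂ)) :
    ∃ (N : ℕ) (C : ℝ), 0 ≤ C ∧ ∀ x, ‖fourierMul m f x‖ ≤ C * (1 + ‖x‖) ^ N := by
  obtain ⟨N, C, hC, h⟩ := norm_apply_compSubConst_le f (fourierS n m)
  refine ⟨N, normFactor n * C, mul_nonneg (normFactor_pos n).le hC, fun x => ?_⟩
  rw [fourierMul_eq, norm_mul, Complex.norm_real, Real.norm_of_nonneg (normFactor_pos n).le,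
    mul_assoc]
  exact mul_le_mul_of_nonneg_left (h x) (normFactor_pos n).le

theorem integrable_pow_mul_norm (φ : 𝓢(Eu n, ℂ)) (N : ℕ) :
    Integrable fun x => (1 + ‖x‖) ^ N * ‖φ x‖ := by
  have hw : Continuous fun x : Eu n => (((1 + ‖x‖) ^ N : ℝ) : ℂ) := by fun_prop
  have := (integrable_smul_of_polynomial_growth hw (N := N) (C := 1) (fun x => by
    rw [Complex.norm_real, Real.norm_of_nonneg (by positivity), one_mul]) φ).norm
  refine this.congr (ae_of_all _ fun x => ?_)
  simp only [norm_smul, Complex.norm_real]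
  rw [Real.norm_of_nonneg (by positivity), mul_comm]

theorem integrable_fourierMul_mul_mul (m₁ m₂ φ : 𝓢(Eu n, ℂ)) (f g : 𝓢'(Eu n, ℂ)) :
    Integrable fun x => fourierMul m₁ f x * fourierMul m₂ g x * φ x := by
  obtain ⟨N, C, hC, hf⟩ := norm_fourierMul_le m₁ f
  obtain ⟨M, D, hD, hg⟩ := norm_fourierMul_le m₂ g
  have := integrable_smul_of_polynomial_growth
    ((continuous_fourierMul m₁ f).mul (continuous_fourierMul m₂ g)) (N := N + M) (C := C * D)
    (fun x => by
      rw [Pi.mul_apply, norm_mul, pow_add, mul_mul_mul_comm]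
      exact mul_le_mul (hf x) (hg x) (norm_nonneg _) (by positivity)) φ
  refine this.congr (ae_of_all _ fun x => ?_)
  simp only [smul_eq_mul, Pi.mul_apply]
  ring

/-- If `a = 1` on `supp m₁` and `F⁻¹ φ` vanishes on `supp a + supp m₂`, then
`∫ F⁻¹[m₁ F f] F⁻¹[m₂ F g] φ = 0`. -/
theorem integral_fourierMul_mul_fourierMul_eq_zero {m₁ m₂ a θ : 𝓢(Eu n, ℂ)} (f g : 𝓢'(Eu n, ℂ))
    (h₁ : mulS m₁ a = m₁) (h₂ : ∀ ξ η, m₂ η ≠ 0 → a ξ * θ (ξ + η) = 0) :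
    ∫ x, fourierMul m₁ f x * fourierMul m₂ g x * fourierS n θ x = 0 := by
  set u := fourierMul m₁ f with hu
  set v := fourierMul m₂ g with hv
  obtain ⟨N, C, hC, hf⟩ := norm_fourierMul_le m₁ f
  obtain ⟨M, D, hD, hg⟩ := norm_fourierMul_le m₂ g
  -- Integrability for Fubini: the growth of `u` at `y` is at most its growth at `y - x` times that
  -- at `x`, and both are absorbed by the Schwartz factors `F a` and `F θ`.
  have hint : Integrable (fun p : Eu n × Eu n =>
      u p.1 * fourierS n a (p.1 - p.2) * (v p.2 * fourierS n θ p.2)) (volume.prod volume) := by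
    have h0 := Integrable.convolution_integrand (ContinuousLinearMap.mul ℝ ℝ)
      (integrable_pow_mul_norm (fourierS n θ) (N + M)) (integrable_pow_mul_norm (fourierS n a) N)
    refine (h0.const_mul (C * D)).mono' ?_ (ae_of_all _ fun p => ?_)
    · have c1 := continuous_fourierMul m₁ f
      have c2 := continuous_fourierMul m₂ g
      have c3 := (fourierS n a).continuous
      have c4 := (fourierS n θ).continuous
      have : Continuous fun p : Eu n × Eu n =>
          u p.1 * fourierS n a (p.1 - p.2) * (v p.2 * fourierS n θ p.2) := by fun_prop
      exact this.aestronglyMeasurable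
    · have h2 : (1 + ‖p.1‖) ≤ (1 + ‖p.1 - p.2‖) * (1 + ‖p.2‖) := by
        have h3 : ‖p.1‖ ≤ ‖p.1 - p.2‖ + ‖p.2‖ := by simpa using norm_add_le (p.1 - p.2) p.2
        nlinarith [mul_nonneg (norm_nonneg (p.1 - p.2)) (norm_nonneg p.2)]
      simp only [norm_mul, ContinuousLinearMap.mul_apply']
      calc ‖u p.1‖ * ‖fourierS n a (p.1 - p.2)‖ * (‖v p.2‖ * ‖fourierS n θ p.2‖)
          ≤ (C * (1 + ‖p.1‖) ^ N) * ‖fourierS n a (p.1 - p.2)‖ *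
            ((D * (1 + ‖p.2‖) ^ M) * ‖fourierS n θ p.2‖) := by
            gcongr
            · exact hf _
            · exact hg _
        _ ≤ (C * ((1 + ‖p.1 - p.2‖) * (1 + ‖p.2‖)) ^ N) * ‖fourierS n a (p.1 - p.2)‖ *
            ((D * (1 + ‖p.2‖) ^ M) * ‖fourierS n θ p.2‖) := by gcongr
        _ = _ := by rw [mul_pow, pow_add]; ring
  -- For fixed `y` the remaining factors form one Schwartz function `Ψ`, so the integral is `F g`
  -- applied to `m₂ · F⁻¹ Ψ`. Here `F⁻¹ Ψ` at `η` equals `F (a · θ(· + η))` at `y`, which vanishes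
  -- wherever `m₂ η ≠ 0`.
  have hinner : ∀ y, ∫ x, u y * fourierS n a (y - x) * (v x * fourierS n θ x) = 0 := by
    intro y
    set Ψ : 𝓢(Eu n, ℂ) := mulS
      (compSubConstCLM ℂ y (dilate (-1) (by norm_num) (fourierS n a))) (fourierS n θ) with hΨ
    have hΨx : ∀ x, Ψ x = fourierS n a (y - x) * fourierS n θ x := by
      intro x
      rw [hΨ, mulS_apply, compSubConstCLM_apply, dilate_apply, neg_one_smul, neg_sub]
    have h3 : mulS m₂ (fourierSInv n Ψ) = 0 := by
      ext η
      rw [mulS_apply]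
      by_cases hη : m₂ η = 0
      · simp [hη]
      · have h4 : mulS a (compSubConstCLM ℂ (-η) θ) = 0 := by
          ext ξ
          rw [mulS_apply, compSubConstCLM_apply, sub_neg_eq_add, h₂ ξ η hη]
          rfl
        have h5 := congrArg (fun ψ : 𝓢(Eu n, ℂ) => ψ y)
          (conv_fourierS (compSubConstCLM ℂ (-η) θ) a)
        simp only [h4, map_zero, smul_apply, conv_apply] at h5
        have h6 : fourierSInv n Ψ η = 0 := by
          rw [fourierSInv_apply_eq, fourierS_apply]
          refine Eq.trans ?_ h5
          rw [smul_eq_mul]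
          congr 1
          refine integral_congr_ae (ae_of_all _ fun x => ?_)
          simp only [hΨx, fourierS_compSubConst]
          ring
        rw [h6, mul_zero]
        rfl
    have h7 := integral_fourierMul_mul m₂ (fourierSInv n Ψ) g
    rw [h3, map_zero, fourierS_fourierSInv] at h7
    calc ∫ x, u y * fourierS n a (y - x) * (v x * fourierS n θ x)
        = ∫ x, u y * (v x * Ψ x) := by
          refine integral_congr_ae (ae_of_all _ fun x => ?_)
          simp only [hΨx]
          ring
      _ = 0 := by rw [integral_const_mul, h7, mul_zero]
  -- Reproducing formula: since `m₁ a = m₁`, convolving `u` with the kernel of `a` returns `u`.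
  have hux : ∀ x, u x = (normFactor n : ℂ) * ∫ y, u y * fourierS n a (y - x) := by
    intro x
    have := fourierMul_mulS m₁ a f x
    rwa [h₁] at this
  calc ∫ x, u x * v x * fourierS n θ x
      = ∫ x, (normFactor n : ℂ) * ∫ y, u y * fourierS n a (y - x) * (v x * fourierS n θ x) := by
        refine integral_congr_ae (ae_of_all _ fun x => ?_)
        simp only
        rw [integral_mul_const, ← mul_assoc, ← hux x]
        ring
    _ = (normFactor n : ℂ) *
          ∫ x, ∫ y, u y * fourierS n a (y - x) * (v x * fourierS n θ x) := integral_const_mul _ _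
    _ = (normFactor n : ℂ) *
          ∫ y, ∫ x, u y * fourierS n a (y - x) * (v x * fourierS n θ x) := by
        rw [integral_integral_swap (f := fun y x =>
          u y * fourierS n a (y - x) * (v x * fourierS n θ x)) hint]
    _ = 0 := by simp [hinner]

/-! ### Schur's test and Hölder's inequality for extended nonnegative functions. -/

section Schur

variable {α : Type*} [MeasurableSpace α] {μ : Measure α}

/-- Hölder's inequality with respect to the measure `k dμ`: write `k = k^(1/r') · k^(1/r)`. -/
theorem lintegral_mul_rpow_le {k u : α → ℝ≥0∞} (hk : AEMeasurable k μ) (hu : AEMeasurable u μ)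
    {r : ℝ} (hr : 1 ≤ r) :
    (∫⁻ y, k y * u y ∂μ) ^ r ≤ (∫⁻ y, k y ∂μ) ^ (r - 1) * ∫⁻ y, k y * u y ^ r ∂μ := by
  rcases hr.eq_or_lt with rfl | hr1
  · simp
  have hr0 : 0 < r := by linarith
  have hc : r.HolderConjugate (r.conjExponent) := Real.HolderConjugate.conjExponent hr1
  set r' := r.conjExponent
  have h := ENNReal.lintegral_mul_le_Lp_mul_Lq μ hc.symm (f := fun y => k y ^ (1 / r'))
    (g := fun y => k y ^ (1 / r) * u y) (hk.pow_const _) ((hk.pow_const _).mul hu)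
  have e1 : ∀ y, k y ^ (1 / r') * (k y ^ (1 / r) * u y) = k y * u y := by
    intro y
    rw [← mul_assoc, ← ENNReal.rpow_add_of_nonneg _ _ (one_div_nonneg.2 hc.symm.nonneg)
      (one_div_nonneg.2 hr0.le)]
    have : 1 / r' + 1 / r = 1 := by
      have := hc.symm.inv_add_inv_eq_one
      simpa using this
    rw [this, ENNReal.rpow_one]
  have e2 : ∀ y, (k y ^ (1 / r')) ^ r' = k y := by
    intro y
    rw [← ENNReal.rpow_mul, one_div_mul_cancel hc.symm.ne_zero, ENNReal.rpow_one]
  have e3 : ∀ y, (k y ^ (1 / r) * u y) ^ r = k y * u y ^ r := by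
    intro y
    rw [ENNReal.mul_rpow_of_nonneg _ _ hr0.le, ← ENNReal.rpow_mul,
      one_div_mul_cancel hr0.ne', ENNReal.rpow_one]
  simp only [Pi.mul_apply, e1, e2, e3] at h
  calc (∫⁻ y, k y * u y ∂μ) ^ r
      ≤ ((∫⁻ y, k y ∂μ) ^ (1 / r') * (∫⁻ y, k y * u y ^ r ∂μ) ^ (1 / r)) ^ r :=
        ENNReal.rpow_le_rpow h hr0.le
    _ = _ := by
        rw [ENNReal.mul_rpow_of_nonneg _ _ hr0.le, ← ENNReal.rpow_mul, ← ENNReal.rpow_mul,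
          one_div_mul_cancel hr0.ne', ENNReal.rpow_one]
        congr 2
        have := hc.inv_add_inv_eq_one
        have h1 : r'⁻¹ = 1 - r⁻¹ := by linarith
        rw [one_div, h1, sub_mul, inv_mul_cancel₀ hr0.ne', one_mul]

/-- Schur's test. -/
theorem eLpNorm_lintegral_kernel_le [SFinite μ] {κ : α → α → ℝ≥0∞}
    (hκ : Measurable (Function.uncurry κ)) {u : α → ℝ≥0∞} (hu : Measurable u) {A : ℝ≥0∞}
    (h₁ : ∀ x, ∫⁻ y, κ x y ∂μ ≤ A) (h₂ : ∀ y, ∫⁻ x, κ x y ∂μ ≤ A) {p : ℝ≥0∞} (hp : 1 ≤ p) :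
    eLpNorm (fun x => ∫⁻ y, κ x y * u y ∂μ) p μ ≤ A * eLpNorm u p μ := by
  have hκx : ∀ x, Measurable (κ x) := fun x => hκ.comp measurable_prodMk_left
  rcases eq_or_ne p ⊤ with rfl | hp_top
  · rw [eLpNorm_exponent_top, eLpNorm_exponent_top]
    refine essSup_le_of_ae_le _ (ae_of_all _ fun x => ?_)
    change ∫⁻ y, κ x y * u y ∂μ ≤ _
    calc ∫⁻ y, κ x y * u y ∂μ ≤ ∫⁻ y, κ x y * eLpNormEssSup u μ ∂μ := by
          refine lintegral_mono_ae ?_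
          filter_upwards [enorm_ae_le_eLpNormEssSup u μ] with y hy
          exact mul_le_mul_right hy _
      _ = (∫⁻ y, κ x y ∂μ) * eLpNormEssSup u μ := lintegral_mul_const _ (hκx x)
      _ ≤ _ := mul_le_mul_left (h₁ x) _
  · have hp0 : p ≠ 0 := (zero_lt_one.trans_le hp).ne'
    have hr : 1 ≤ p.toReal := by
      rw [← ENNReal.toReal_one]
      exact ENNReal.toReal_mono hp_top hp
    have hr0 : 0 < p.toReal := by linarith
    set r := p.toReal
    rw [eLpNorm_eq_lintegral_rpow_enorm_toReal hp0 hp_top,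
      eLpNorm_eq_lintegral_rpow_enorm_toReal hp0 hp_top]
    simp only [enorm_eq_self]
    -- The row bound enters through Hölder and gives `A ^ (r - 1)`; after Tonelli the column bound
    -- gives the last factor `A`.
    have hmain : ∫⁻ x, (∫⁻ y, κ x y * u y ∂μ) ^ r ∂μ ≤ A ^ r * ∫⁻ y, u y ^ r ∂μ := by
      calc ∫⁻ x, (∫⁻ y, κ x y * u y ∂μ) ^ r ∂μ
          ≤ ∫⁻ x, A ^ (r - 1) * ∫⁻ y, κ x y * u y ^ r ∂μ ∂μ := by
            refine lintegral_mono fun x => ?_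
            refine (lintegral_mul_rpow_le (hκx x).aemeasurable hu.aemeasurable hr).trans ?_
            exact mul_le_mul_left (ENNReal.rpow_le_rpow (h₁ x) (by linarith)) _
        _ = A ^ (r - 1) * ∫⁻ x, ∫⁻ y, κ x y * u y ^ r ∂μ ∂μ := by
            refine lintegral_const_mul _ ?_
            have hm : Measurable (Function.uncurry fun x y => κ x y * u y ^ r) :=
              hκ.mul ((hu.comp measurable_snd).pow_const _)
            exact hm.lintegral_prod_right
        _ = A ^ (r - 1) * ∫⁻ y, (∫⁻ x, κ x y ∂μ) * u y ^ r ∂μ := by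
            rw [lintegral_lintegral_swap]
            · congr 1
              refine lintegral_congr fun y => ?_
              exact lintegral_mul_const _ (hκ.comp measurable_prodMk_right)
            · exact (hκ.mul ((hu.comp measurable_snd).pow_const _)).aemeasurable
        _ ≤ A ^ (r - 1) * ∫⁻ y, A * u y ^ r ∂μ := by
            gcongr with y
            exact h₂ y
        _ = A ^ (r - 1) * A * ∫⁻ y, u y ^ r ∂μ := by
            rw [lintegral_const_mul _ (hu.pow_const _), mul_assoc]
        _ = _ := by
            congr 1
            nth_rewrite 2 [← ENNReal.rpow_one A]
            rw [← ENNReal.rpow_add_of_nonneg _ _ (by linarith) zero_le_one, sub_add_cancel]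
    calc (∫⁻ x, (∫⁻ y, κ x y * u y ∂μ) ^ r ∂μ) ^ (1 / r)
        ≤ (A ^ r * ∫⁻ y, u y ^ r ∂μ) ^ (1 / r) := ENNReal.rpow_le_rpow hmain (by positivity)
      _ = _ := by
        rw [ENNReal.mul_rpow_of_nonneg _ _ (by positivity), ← ENNReal.rpow_mul,
          mul_one_div_cancel hr0.ne', ENNReal.rpow_one]

/-- Hölder's inequality for conjugate extended exponents. -/
theorem lintegral_mul_le_eLpNorm_mul_eLpNorm {f g : α → ℝ≥0∞} (hf : AEMeasurable f μ)
    (hg : AEMeasurable g μ) {q q' : ℝ≥0∞} (hq : 1 < q) (hqq' : 1 / q + 1 / q' = 1) :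
    ∫⁻ x, f x * g x ∂μ ≤ eLpNorm f q' μ * eLpNorm g q μ := by
  rcases eq_or_ne q ⊤ with rfl | hq_top
  · have : q' = 1 := by simpa using hqq'
    rw [this, eLpNorm_one_eq_lintegral_enorm, eLpNorm_exponent_top, mul_comm,
      ← lintegral_const_mul'' _ hf.enorm]
    refine lintegral_mono_ae ?_
    filter_upwards [enorm_ae_le_eLpNormEssSup g μ] with y hy
    rw [mul_comm]
    exact mul_le_mul_left hy _
  · have hc : ENNReal.HolderConjugate q q' :=
      ENNReal.holderConjugate_iff.2 (by simpa using hqq')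
    have hq'_top : q' ≠ ⊤ := by
      rintro rfl
      simp only [one_div, ENNReal.inv_top, add_zero, ENNReal.inv_eq_one] at hqq'
      exact hq.ne' hqq'
    have hq0 : q ≠ 0 := (zero_lt_one.trans hq).ne'
    have hq'0 : q' ≠ 0 := by
      rintro rfl
      simp at hqq'
    have hr : 1 < q.toReal := by
      rw [← ENNReal.toReal_one]
      exact (ENNReal.toReal_lt_toReal ENNReal.one_ne_top hq_top).2 hq
    have hconj : q'.toReal.HolderConjugate q.toReal := by
      refine (Real.holderConjugate_iff.2 ⟨hr, ?_⟩).symm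
      have := congrArg ENNReal.toReal hqq'
      rw [ENNReal.toReal_add (by simp [hq0]) (by simp [hq'0])] at this
      simpa using this
    rw [eLpNorm_eq_lintegral_rpow_enorm_toReal hq'0 hq'_top,
      eLpNorm_eq_lintegral_rpow_enorm_toReal hq0 hq_top]
    simpa using ENNReal.lintegral_mul_le_Lp_mul_Lq μ hconj hf hg

end Schur

/-! ### Lattice sums and brackets. -/

section Lattice

/-- The norm is the supremum norm on `ℤⁿ`. The term at `a = 0` is `0 ^ (-t) = 0` by convention,
which is convenient in the tail estimate. -/
theorem summable_norm_rpow_int {t : ℝ} (ht : n < t) :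
    Summable fun a : Fin n → ℤ => ‖a‖ ^ (-t) := by
  let b := Pi.basisFun ℝ (Fin n)
  let L : Submodule ℤ (Fin n → ℝ) := Submodule.span ℤ (Set.range b)
  have hr : Module.finrank ℤ L = n := by
    rw [ZLattice.rank ℝ L]
    simp
  have h := ZLattice.summable_norm_rpow L (-t) (by rw [hr]; linarith)
  let φ : (Fin n → ℤ) → L := fun a => ∑ i, a i • (⟨b i, Submodule.subset_span ⟨i, rfl⟩⟩ : L)
  have hφ : ∀ a, (φ a : Fin n → ℝ) = fun i => (a i : ℝ) := by
    intro a
    funext j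
    simp [φ, b, Finset.sum_apply, Pi.single_apply]
  have hinj : Function.Injective φ := by
    intro a a' haa
    funext j
    have := congrFun ((hφ a).symm.trans ((congrArg _ haa).trans (hφ a'))) j
    exact_mod_cast this
  refine (h.comp_injective hinj).congr fun a => ?_
  have : ‖φ a‖ = ‖a‖ := by
    rw [Submodule.coe_norm, hφ]
    refine le_antisymm ((pi_norm_le_iff_of_nonneg (norm_nonneg _)).2 fun i => ?_)
      ((pi_norm_le_iff_of_nonneg (norm_nonneg _)).2 fun i => ?_)
    · have := norm_le_pi_norm a i
      simpa [Int.norm_eq_abs] using this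
    · have := norm_le_pi_norm (fun i => (a i : ℝ)) i
      simpa [Int.norm_eq_abs] using this
  change ‖φ a‖ ^ (-t) = _
  rw [this]

theorem norm_apply_le_norm_latticePt (k : Fin n → ℤ) (i : Fin n) : |(k i : ℝ)| ≤ ‖latticePt k‖ := by
  have := PiLp.norm_apply_le (latticePt k) i
  simpa [latticePt] using this

theorem one_le_bracket (ξ : Eu n) : 1 ≤ bracket ξ := by
  rw [bracket, Real.one_le_sqrt]
  nlinarith [sq_nonneg ‖ξ‖]

theorem bracket_pos (ξ : Eu n) : 0 < bracket ξ := zero_lt_one.trans_le (one_le_bracket ξ)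

theorem norm_le_bracket (ξ : Eu n) : ‖ξ‖ ≤ bracket ξ :=
  Real.le_sqrt_of_sq_le (by linarith)

/-- The tail of the series `∑ ⟨l⟩^{-t}` over the lattice, for `t > n`. -/
theorem tsum_bracket_tail_le {t : ℝ} (ht : n < t) :
    ∃ C : ℝ, 0 ≤ C ∧ ∀ N : ℕ, 1 ≤ N →
      ∑' l : Fin n → ℤ, (if ∃ i, (N : ℤ) ≤ |l i| then
        ENNReal.ofReal (bracket (latticePt l) ^ (-t)) else 0)
      ≤ ENNReal.ofReal (C * (N : ℝ) ^ (n - t)) := by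
  have ht0 : 0 < t := (Nat.cast_nonneg n).trans_lt ht
  have hsum := summable_norm_rpow_int (n := n) ht
  set Z : ℝ := ∑' a : Fin n → ℤ, ‖a‖ ^ (-t) with hZ
  have hZ0 : 0 ≤ Z := tsum_nonneg fun a => Real.rpow_nonneg (norm_nonneg _) _
  refine ⟨2 ^ n * Z, by positivity, fun N hN => ?_⟩
  have hNpos : (0 : ℝ) < N := by exact_mod_cast hN
  have hNZ : (0 : ℤ) < N := by exact_mod_cast hN
  -- Divide `l` by `N` coordinatewise, truncating towards zero. At most `(2N)^n` remainders occur,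
  -- and a point with a coordinate of modulus at least `N` has a nonzero quotient `a` with `N ‖a‖ ≤
  -- |l|`. The tail is thus at most `(2N)^n N^(-t)` times the full sum over `a`.
  let B : Finset (Fin n → ℤ) := Fintype.piFinset fun _ => Finset.Ioo (-(N : ℤ)) N
  have hmodB : ∀ l : Fin n → ℤ, (fun i => (l i).tmod N) ∈ B := by
    intro l
    refine Fintype.mem_piFinset.2 fun i => Finset.mem_Ioo.2 ?_
    have := Int.natAbs_tmod (l i) N
    have h2 := Nat.mod_lt (l i).natAbs (show 0 < (N : ℤ).natAbs by omega)
    constructor <;> omega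
  have hB : (B.card : ℝ) ≤ 2 ^ n * (N : ℝ) ^ n := by
    rw [Fintype.card_piFinset]
    simp only [Int.card_Ioo, Finset.prod_const, Finset.card_univ, Fintype.card_fin]
    rw [← mul_pow]
    push_cast
    refine pow_le_pow_left₀ (by positivity) ?_ n
    have : ((N : ℤ) - -(N : ℤ) - 1).toNat ≤ 2 * N := by omega
    exact_mod_cast this
  let dm : (Fin n → ℤ) → (Fin n → ℤ) × B := fun l =>
    (fun i => (l i).tdiv N, ⟨fun i => (l i).tmod N, hmodB l⟩)
  have hdm : Function.Injective dm := by
    intro l l' h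
    funext i
    have h1 : (l i).tdiv N = (l' i).tdiv N := congrFun (congrArg Prod.fst h) i
    have h2 : (l i).tmod N = (l' i).tmod N :=
      congrFun (congrArg (fun z : (Fin n → ℤ) × B => (z.2 : Fin n → ℤ)) h) i
    rw [← Int.tmod_add_mul_tdiv (l i) N, ← Int.tmod_add_mul_tdiv (l' i) N, h1, h2]
  have hterm : ∀ l : Fin n → ℤ, (if ∃ i, (N : ℤ) ≤ |l i| then
      ENNReal.ofReal (bracket (latticePt l) ^ (-t)) else 0)
      ≤ ENNReal.ofReal ((N : ℝ) ^ (-t) * ‖(dm l).1‖ ^ (-t)) := by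
    intro l
    split_ifs with h
    · obtain ⟨i, hi⟩ := h
      have hq : ∀ j, (N : ℝ) * |(((l j).tdiv N : ℤ) : ℝ)| ≤ |(l j : ℝ)| := by
        intro j
        have h1 : ((l j).tdiv N).natAbs = (l j).natAbs / N := Int.natAbs_tdiv (l j) N
        have h3 : N * ((l j).tdiv N).natAbs ≤ (l j).natAbs := by
          rw [h1, mul_comm]
          exact Nat.div_mul_le_self _ _
        have h4 : (N : ℤ) * |(l j).tdiv N| ≤ |l j| := by
          rw [Int.abs_eq_natAbs, Int.abs_eq_natAbs]
          exact_mod_cast h3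
        exact_mod_cast h4
      have hpos : 0 < ‖(dm l).1‖ := by
        rw [norm_pos_iff]
        intro h0
        have h1 : (l i).tdiv N = 0 := congrFun h0 i
        have h2 : ((l i).tdiv N).natAbs = (l i).natAbs / N := Int.natAbs_tdiv (l i) N
        rw [h1, Int.natAbs_zero] at h2
        have h3 : N ≤ (l i).natAbs := by
          rw [Int.abs_eq_natAbs] at hi
          exact_mod_cast hi
        have h4 : 1 ≤ (l i).natAbs / N := (Nat.one_le_div_iff hN).2 h3
        omega
      have hle : (N : ℝ) * ‖(dm l).1‖ ≤ bracket (latticePt l) := by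
        refine le_trans ?_ (norm_le_bracket _)
        rw [mul_comm, ← le_div_iff₀ hNpos]
        refine (pi_norm_le_iff_of_nonneg (by positivity)).2 fun j => ?_
        rw [le_div_iff₀ hNpos, mul_comm, Int.norm_eq_abs]
        exact (hq j).trans (norm_apply_le_norm_latticePt l j)
      refine ENNReal.ofReal_le_ofReal ?_
      rw [← Real.mul_rpow hNpos.le hpos.le]
      exact Real.rpow_le_rpow_of_nonpos (by positivity) hle (by linarith)
    · exact zero_le
  calc ∑' l : Fin n → ℤ, (if ∃ i, (N : ℤ) ≤ |l i| then
        ENNReal.ofReal (bracket (latticePt l) ^ (-t)) else 0)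
      ≤ ∑' l : Fin n → ℤ, (fun z : (Fin n → ℤ) × B =>
          ENNReal.ofReal ((N : ℝ) ^ (-t) * ‖z.1‖ ^ (-t))) (dm l) := ENNReal.tsum_le_tsum hterm
    _ ≤ ∑' z : (Fin n → ℤ) × B, ENNReal.ofReal ((N : ℝ) ^ (-t) * ‖z.1‖ ^ (-t)) :=
        ENNReal.tsum_comp_le_tsum_of_injective hdm _
    _ = ∑' a : Fin n → ℤ, ENNReal.ofReal (B.card * ((N : ℝ) ^ (-t) * ‖a‖ ^ (-t))) := by
        rw [ENNReal.tsum_prod']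
        refine tsum_congr fun a => ?_
        rw [tsum_fintype]
        simp only [Finset.sum_const, nsmul_eq_mul, Finset.card_univ, Fintype.card_coe]
        rw [ENNReal.ofReal_mul (p := (B.card : ℝ)) (by positivity), ENNReal.ofReal_natCast]
    _ = ENNReal.ofReal (∑' a : Fin n → ℤ, B.card * ((N : ℝ) ^ (-t) * ‖a‖ ^ (-t))) := by
        rw [ENNReal.ofReal_tsum_of_nonneg (fun a => by positivity)]
        exact (hsum.mul_left _).mul_left _
    _ ≤ ENNReal.ofReal (2 ^ n * Z * (N : ℝ) ^ (n - t)) := by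
        refine ENNReal.ofReal_le_ofReal ?_
        rw [tsum_mul_left, tsum_mul_left, ← hZ, sub_eq_add_neg, Real.rpow_add hNpos,
          Real.rpow_natCast]
        calc (B.card : ℝ) * ((N : ℝ) ^ (-t) * Z) ≤ 2 ^ n * (N : ℝ) ^ n * ((N : ℝ) ^ (-t) * Z) := by
              gcongr
          _ = _ := by ring

end Lattice

/-! ### Young's inequality -/

theorem eLpNorm_integral_kernel_le (K : 𝓢(Eu n, ℂ)) {u : Eu n → ℂ} (hu : Continuous u) {p : ℝ≥0∞}
    (hp : 1 ≤ p) :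
    eLpNorm (fun x => ∫ y, u y * K (y - x)) p volume
      ≤ eLpNorm K 1 volume * eLpNorm u p volume := by
  have hK := K.continuous
  calc eLpNorm (fun x => ∫ y, u y * K (y - x)) p volume
      ≤ eLpNorm (fun x => ∫⁻ y, ‖K (y - x)‖ₑ * ‖u y‖ₑ) p volume := by
        refine eLpNorm_mono_enorm fun x => ?_
        rw [enorm_eq_self]
        refine (enorm_integral_le_lintegral_enorm _).trans_eq ?_
        simp only [enorm_mul, mul_comm]
    _ ≤ eLpNorm K 1 volume * eLpNorm (fun y => ‖u y‖ₑ) p volume := by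
        refine eLpNorm_lintegral_kernel_le (κ := fun x y => ‖K (y - x)‖ₑ) ?_
          hu.enorm.measurable (fun x => ?_) (fun y => ?_) hp
        · have : Continuous fun z : Eu n × Eu n => ‖K (z.2 - z.1)‖ₑ := by fun_prop
          exact this.measurable
        · rw [eLpNorm_one_eq_lintegral_enorm,
            lintegral_sub_right_eq_self (fun y => ‖K y‖ₑ) x]
        · rw [eLpNorm_one_eq_lintegral_enorm,
            lintegral_sub_left_eq_self (fun y => ‖K y‖ₑ) y]
    _ = _ := by rw [eLpNorm_enorm]

/-- An additional symbol acts as convolution with its kernel, so it costs only the `L¹` norm of that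
kernel. This norm does not change under dilation of `m'`, whence bounds uniform over the cut-offs
`ψ(2^(-j) ·)`. -/
theorem eLpNorm_fourierMul_mulS_le (m m' : 𝓢(Eu n, ℂ)) (f : 𝓢'(Eu n, ℂ)) {p : ℝ≥0∞}
    (hp : 1 ≤ p) :
    eLpNorm (fourierMul (mulS m m') f) p volume
      ≤ ENNReal.ofReal (normFactor n) * eLpNorm (fourierS n m') 1 volume *
        eLpNorm (fourierMul m f) p volume := by
  have e : fourierMul (mulS m m') f = (normFactor n : ℂ) •
      fun x => ∫ y, fourierMul m f y * fourierS n m' (y - x) :=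
    funext fun x => fourierMul_mulS m m' f x
  rw [e, eLpNorm_const_smul, mul_assoc]
  have : ‖(normFactor n : ℂ)‖ₑ = ENNReal.ofReal (normFactor n) := by
    rw [← ofReal_norm, Complex.norm_real, Real.norm_of_nonneg (normFactor_pos n).le]
  rw [this]
  exact mul_le_mul_right (eLpNorm_integral_kernel_le _ (continuous_fourierMul m f) hp) _

/-! ### Dilations and translations of symbols -/

theorem fourierS_dilate (a : ℝ) (ha : a ≠ 0) (ψ : 𝓢(Eu n, ℂ)) (ξ : Eu n) :
    fourierS n (dilate a ha ψ) ξ = ((|a| ^ n)⁻¹ : ℝ) • fourierS n ψ (a⁻¹ • ξ) := by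
  rw [fourierS_apply, fourierS_apply]
  have h := Measure.integral_comp_smul (volume : Measure (Eu n))
    (fun x : Eu n => Complex.exp (Complex.I * (inner ℝ x (a⁻¹ • ξ) : ℝ)) * ψ x) a
  rw [finrank_euclideanSpace_fin, abs_inv, abs_pow] at h
  rw [← mul_smul_comm, ← h]
  congr 1
  refine integral_congr_ae (ae_of_all _ fun x => ?_)
  simp only [dilate_apply, inner_smul_left, inner_smul_right]
  congr 4
  simp
  field_simp

theorem eLpNorm_fourierS_dilate (a : ℝ) (ha : a ≠ 0) (ψ : 𝓢(Eu n, ℂ)) :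
    eLpNorm (fourierS n (dilate a ha ψ)) 1 volume = eLpNorm (fourierS n ψ) 1 volume := by
  rw [eLpNorm_one_eq_lintegral_enorm, eLpNorm_one_eq_lintegral_enorm,
    ← ofReal_integral_norm_eq_lintegral_enorm (fourierS n _).integrable,
    ← ofReal_integral_norm_eq_lintegral_enorm (fourierS n _).integrable]
  congr 1
  simp only [fourierS_dilate, norm_smul]
  rw [integral_const_mul, Measure.integral_comp_smul (volume : Measure (Eu n))
    (fun x : Eu n => ‖fourierS n ψ x‖) a⁻¹, finrank_euclideanSpace_fin, smul_eq_mul, ← mul_assoc]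
  have : |a| ^ n ≠ 0 := pow_ne_zero _ (abs_ne_zero.2 ha)
  rw [norm_inv, norm_pow, Real.norm_eq_abs, abs_abs, inv_pow, inv_inv, abs_pow,
    inv_mul_cancel₀ this, one_mul]

theorem eLpNorm_fourierS_compSubConst (m : 𝓢(Eu n, ℂ)) (η : Eu n) (p : ℝ≥0∞) :
    eLpNorm (fourierS n (compSubConstCLM ℂ η m)) p volume = eLpNorm (fourierS n m) p volume := by
  refine eLpNorm_congr_norm_ae (ae_of_all _ fun x => ?_)
  rw [fourierS_compSubConst, norm_mul, mul_comm Complex.I, Complex.norm_exp_ofReal_mul_I, one_mul]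

namespace Window

variable (ρ : Window n)

theorem latticePt_add (k l : Fin n → ℤ) : latticePt (k + l) = latticePt k + latticePt l := by
  ext i
  simp [latticePt]

theorem latticePt_sub (k l : Fin n → ℤ) : latticePt (k - l) = latticePt k - latticePt l := by
  ext i
  simp [latticePt]

theorem translate_sub (k l : Fin n → ℤ) (ξ : Eu n) :
    ρ.translate k (ξ - latticePt l) = ρ.translate (k + l) ξ := by
  rw [translate, translate, latticePt_add, sub_sub, add_comm]

theorem total_sub (l : Fin n → ℤ) (ξ : Eu n) : ρ.total (ξ - latticePt l) = ρ.total ξ := by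
  rw [total, total]
  simp only [translate_sub]
  exact finsum_comp_equiv (Equiv.addRight l) (f := fun k => ρ.translate k ξ)

/-- The denominator `∑ ρ_l` is periodic, so all `σ_k` are translates of one function and their
kernels differ only by unimodular factors. -/
theorem sigmaS_eq_compSubConst (k : Fin n → ℤ) :
    ρ.sigmaS k = compSubConstCLM ℂ (latticePt k) (ρ.sigmaS 0) := by
  ext ξ
  rw [compSubConstCLM_apply, sigmaS_apply, sigmaS_apply, sigma, sigma, total_sub, translate_sub,
    zero_add]

theorem eLpNorm_fourierS_sigmaS (k : Fin n → ℤ) (p : ℝ≥0∞) :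
    eLpNorm (fourierS n (ρ.sigmaS k)) p volume = eLpNorm (fourierS n (ρ.sigmaS 0)) p volume := by
  rw [sigmaS_eq_compSubConst, eLpNorm_fourierS_compSubConst]

theorem abs_le_of_sigmaS_ne_zero {k : Fin n → ℤ} {ξ : Eu n} (h : ρ.sigmaS k ξ ≠ 0) (i : Fin n) :
    |ξ i - k i| ≤ 1 := by
  refine ρ.abs_le_of_translate_ne_zero (fun h0 => h ?_) i
  rw [sigmaS_apply, sigma, h0]
  simp

theorem sum_sigmaS {ξ : Eu n} {S : Finset (Fin n → ℤ)}
    (hS : ∀ k, (∀ i, |ξ i - k i| ≤ 1) → k ∈ S) : ∑ k ∈ S, ρ.sigmaS k ξ = 1 := by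
  have h1 : ρ.total ξ = ∑ k ∈ S, ρ.translate k ξ := by
    refine finsum_eq_sum_of_support_subset _ fun k hk => ?_
    exact hS k fun i => ρ.abs_le_of_translate_ne_zero hk i
  have h2 : ∑ k ∈ S, ρ.sigma k ξ = 1 := by
    simp only [sigma]
    rw [← Finset.sum_div, ← h1, div_self (zero_lt_one.trans_le (ρ.one_le_total ξ)).ne']
  simp only [sigmaS_apply]
  exact_mod_cast h2

end Window

/-! ### The support of a tempered distribution -/

/-- The definition of the support gives vanishing only near each point. A subordinate partition of
unity on the compact set `tsupport m` cuts `m` into finitely many pieces, each inside an open set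
where `f` vanishes. -/
theorem apply_eq_zero_of_disjoint_dsupport (f : 𝓢'(Eu n, ℂ)) (m : 𝓢(Eu n, ℂ))
    (hm : HasCompactSupport m) (h : Disjoint (tsupport m) (Distribution.dsupport f)) :
    f m = 0 := by
  have hx : ∀ x : tsupport m, ∃ U : Set (Eu n), IsOpen U ∧ x.1 ∈ U ∧
      Distribution.IsVanishingOn f U := by
    intro x
    have := Set.disjoint_left.1 h x.2
    rw [← Set.mem_compl_iff, Distribution.dsupport_compl_eq] at this
    obtain ⟨U, ⟨h1, h2⟩, h3⟩ := this
    exact ⟨U, h2, h3, h1⟩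
  choose U hUo hUx hUv using hx
  obtain ⟨P, hP⟩ := SmoothPartitionOfUnity.exists_isSubordinate (modelWithCornersSelf ℝ (Eu n))
    (isClosed_tsupport m) U hUo (fun x hx => Set.mem_iUnion.2 ⟨⟨x, hx⟩, hUx ⟨x, hx⟩⟩)
  have hfin := P.locallyFinite.finite_nonempty_inter_compact hm.isCompact
  let piece : tsupport m → 𝓢(Eu n, ℂ) := fun i =>
    HasCompactSupport.toSchwartzMap (f := fun ξ => ((P i ξ : ℝ) : ℂ) * m ξ)
      (hm.mul_left (f := fun ξ => ((P i ξ : ℝ) : ℂ)))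
      ((Complex.ofRealCLM.contDiff.comp (P i).contMDiff.contDiff).mul (m.smooth ⊤))
  have hpiece : ∀ i ξ, piece i ξ = ((P i ξ : ℝ) : ℂ) * m ξ := fun _ _ => rfl
  have hz : ∀ i, f (piece i) = 0 := by
    intro i
    refine hUv i _ (subset_trans ?_ (hP i))
    refine closure_mono fun ξ hξ hp => hξ ?_
    rw [hpiece, hp]
    simp
  have hsum : m = ∑ i ∈ hfin.toFinset, piece i := by
    ext ξ
    rw [sum_apply]
    simp only [hpiece]
    rw [← Finset.sum_mul]
    by_cases hξ : m ξ = 0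
    · simp [hξ]
    · have hξ' : ξ ∈ tsupport m := subset_tsupport _ hξ
      have h1 := P.sum_eq_one hξ'
      rw [finsum_eq_sum_of_support_subset (s := hfin.toFinset) _ fun i hi => by
        rw [Set.Finite.coe_toFinset]
        exact ⟨ξ, hi, hξ'⟩] at h1
      have h2 : ∑ i ∈ hfin.toFinset, ((P i ξ : ℝ) : ℂ) = 1 := by exact_mod_cast h1
      rw [h2, one_mul]
  rw [hsum, map_sum]
  exact Finset.sum_eq_zero fun i _ => hz i

/-- The lattice points whose unit boxes can meet `P_R(ε)`. -/
def orthantLattice (ε : Fin n → Fin 2) (R : ℝ) : Set (Fin n → ℤ) :=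
  {k | (∀ j, 0 ≤ (-1) ^ (ε j : ℕ) * k j) ∧ ∃ j, R - 1 < |(k j : ℝ)|}

/-- A box centred one unit on the wrong side of a coordinate hyperplane only touches it, and the
orthant is open: there the sign is `0`, not `±1`. Indices with a zero coordinate must be kept. -/
theorem disjoint_orthantPiece {ε : Fin n → Fin 2} {R : ℝ} {k : Fin n → ℤ}
    (hk : k ∉ orthantLattice ε R) :
    Disjoint {ξ : Eu n | ∀ i, |ξ i - k i| ≤ 1} (orthantPiece ε R) := by
  refine Set.disjoint_left.2 fun ξ hξ hP => hk ⟨fun j => ?_, ?_⟩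
  · have h1 := hP.1 j
    have h2 := abs_le.1 (hξ j)
    by_contra hneg
    rcases Fin.exists_fin_two.1 ⟨ε j, rfl⟩ with h | h
    · rw [h] at h1 hneg
      simp only [Fin.val_zero, pow_zero, one_mul, not_le] at h1 hneg
      have h3 : (k j : ℝ) ≤ -1 := by exact_mod_cast Int.le_sub_one_of_lt hneg
      have h4 : Real.sign (ξ j) ≤ 0 := by
        rcases (show ξ j ≤ 0 by linarith).eq_or_lt with h | h
        · rw [h, Real.sign_zero]
        · rw [Real.sign_of_neg h]; norm_num
      linarith
    · rw [h] at h1 hneg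
      simp only [Fin.val_one, pow_one, neg_mul, one_mul, not_le] at h1 hneg
      have h3 : (1 : ℝ) ≤ k j := by
        have : 1 ≤ k j := by omega
        exact_mod_cast this
      have h4 : 0 ≤ Real.sign (ξ j) := by
        rcases (show 0 ≤ ξ j by linarith).eq_or_lt with h | h
        · rw [← h, Real.sign_zero]
        · rw [Real.sign_of_pos h]; norm_num
      linarith
  · by_contra hneg
    push Not at hneg
    refine hP.2 fun j => ?_
    have h1 := hneg j
    have h2 := abs_sub_abs_le_abs_sub (ξ j) (k j)
    have h3 : |ξ j - k j| ≤ 1 := hξ j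
    linarith

theorem box_eq_zero (ρ : Window n) {ε : Fin n → Fin 2} {R : ℝ} {f : 𝓢'(Eu n, ℂ)}
    (hf : Distribution.dsupport (fourierD f) ⊆ orthantPiece ε R) {k : Fin n → ℤ}
    (hk : k ∉ orthantLattice ε R) (x : Eu n) : ρ.box k f x = 0 := by
  rw [Window.box, fourierMul]
  have hsub : Function.support (smulLeftCLM ℂ (character x) (ρ.sigmaS k))
      ⊆ Function.support (ρ.sigmaS k) := by
    intro ξ hξ h0
    refine hξ ?_
    rw [smulLeftCLM_apply_apply (character_hasTemperateGrowth x), h0, smul_zero]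
  have hcs : HasCompactSupport (ρ.sigmaS k) :=
    (ρ.sigma_hasCompactSupport k).comp_left Complex.ofReal_zero
  have hclosed : IsClosed {ξ : Eu n | ∀ i, |ξ i - k i| ≤ 1} := by
    have : {ξ : Eu n | ∀ i, |ξ i - k i| ≤ 1} = ⋂ i, {ξ : Eu n | |ξ i - k i| ≤ 1} := by
      ext ξ
      simp
    rw [this]
    exact isClosed_iInter fun i => isClosed_le (by fun_prop) continuous_const
  rw [apply_eq_zero_of_disjoint_dsupport, mul_zero]
  · exact hcs.mono hsub
  · refine Set.disjoint_of_subset ?_ hf (disjoint_orthantPiece hk)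
    refine closure_minimal (hsub.trans fun ξ hξ i => ρ.abs_le_of_sigmaS_ne_zero hξ i) hclosed

/-! ### Integrals of products of band-limited functions -/

theorem exists_cutoff (n : ℕ) {r : ℝ} (hr : 0 ≤ r) :
    ∃ χ : 𝓢(Eu n, ℂ), (∀ ξ, ‖ξ‖ ≤ r → χ ξ = 1) ∧ ∀ ξ, r + 1 ≤ ‖ξ‖ → χ ξ = 0 := by
  let b : ContDiffBump (0 : Eu n) := ⟨r + 1 / 2, r + 1, by linarith, by linarith⟩
  refine ⟨HasCompactSupport.toSchwartzMap (f := fun ξ => (b ξ : ℂ))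
    (b.hasCompactSupport.comp_left Complex.ofReal_zero)
    (Complex.ofRealCLM.contDiff.comp b.contDiff), fun ξ hξ => ?_, fun ξ hξ => ?_⟩
  · change (b ξ : ℂ) = 1
    rw [b.one_of_mem_closedBall, Complex.ofReal_one]
    rw [mem_closedBall_zero_iff]
    change ‖ξ‖ ≤ r + 1 / 2
    linarith
  · change (b ξ : ℂ) = 0
    rw [b.zero_of_le_dist, Complex.ofReal_zero]
    rwa [dist_zero_right]

/-- Continuity of the Fourier transform bounds the `L^p` norm by finitely many seminorms of the
localized function, and these decay in `a` by `seminorm_mulS_compSubConst_le`. The constant and the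
seminorms depend on neither `a` nor `θ`. -/
theorem exists_eLpNorm_fourierS_cutoff_le (χ : 𝓢(Eu n, ℂ)) (p : ℝ≥0∞) (N : ℕ) :
    ∃ (C : ℝ) (s : Finset (ℕ × ℕ)), 0 ≤ C ∧ ∀ (a : Eu n) (θ : 𝓢(Eu n, ℂ)),
      eLpNorm (fourierS n (mulS (compSubConstCLM ℂ a χ) θ)) p volume
        ≤ ENNReal.ofReal (C * ((1 + ‖a‖) ^ N)⁻¹ * s.sup (schwartzSeminormFamily ℂ (Eu n) ℂ) θ) := by
  obtain ⟨k₀, C₀, h₀⟩ := eLpNorm_le_seminorm ℂ ℂ p (volume : Measure (Eu n))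
  set q₁ : Seminorm ℂ 𝓢(Eu n, ℂ) :=
    ((Finset.Iic (k₀, 0)).sup (schwartzSeminormFamily ℂ (Eu n) ℂ)).comp
      (fourierS n).toLinearMap with hq₁
  have hcont : Continuous q₁ := by
    have h1 : Continuous
        ⇑((Finset.Iic (k₀, 0)).sup (schwartzSeminormFamily ℂ (Eu n) ℂ) : Seminorm ℂ 𝓢(Eu n, ℂ)) := by
      exact Seminorm.continuous_finsetSup fun i _ =>
        (schwartz_withSeminorms ℂ (Eu n) ℂ).continuous_seminorm i
    exact h1.comp (fourierS n).continuous
  obtain ⟨s₁, C₁, -, h₁⟩ := Seminorm.bound_of_continuous (schwartz_withSeminorms ℂ (Eu n) ℂ) q₁ hcont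
  choose A hA h using fun i : ℕ × ℕ => seminorm_mulS_compSubConst_le χ N i.1 i.2
  let S : Finset (ℕ × ℕ) := s₁.biUnion fun i => Finset.Iic (i.1 + N, i.2)
  have hsum : 0 ≤ ∑ i ∈ s₁, A i := Finset.sum_nonneg fun i _ => hA i
  refine ⟨C₀ * C₁ * ∑ i ∈ s₁, A i, S, by positivity, fun a θ => ?_⟩
  have ha : 0 < (1 + ‖a‖) ^ N := by positivity
  set T := S.sup (schwartzSeminormFamily ℂ (Eu n) ℂ) θ with hT
  have hT0 : 0 ≤ T := apply_nonneg _ _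
  have h2 : s₁.sup (schwartzSeminormFamily ℂ (Eu n) ℂ) (mulS (compSubConstCLM ℂ a χ) θ)
      ≤ (∑ i ∈ s₁, A i) * ((1 + ‖a‖) ^ N)⁻¹ * T := by
    refine sup_seminorm_le (by positivity) fun i hi => ?_
    have h3 := h i a θ
    rw [mul_assoc, mul_comm ((1 + ‖a‖) ^ N)⁻¹ T, ← mul_assoc, ← div_eq_mul_inv, le_div_iff₀ ha,
      mul_comm]
    refine h3.trans ?_
    have h4 : (Finset.Iic (i.1 + N, i.2)).sup (schwartzSeminormFamily ℂ (Eu n) ℂ) θ ≤ T := by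
      rw [hT]
      refine Seminorm.le_def.1 (Finset.sup_mono ?_) θ
      exact Finset.subset_biUnion_of_mem (fun i : ℕ × ℕ => Finset.Iic (i.1 + N, i.2)) hi
    exact mul_le_mul (Finset.single_le_sum (fun i _ => hA i) hi) h4 (apply_nonneg _ _) hsum
  refine (h₀ _).trans ?_
  have h5 : ((Finset.Iic (k₀, 0)).sup (schwartzSeminormFamily ℂ (Eu n) ℂ))
      (fourierS n (mulS (compSubConstCLM ℂ a χ) θ))
      ≤ C₁ * ((∑ i ∈ s₁, A i) * ((1 + ‖a‖) ^ N)⁻¹ * T) :=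
    (h₁ _).trans (mul_le_mul_of_nonneg_left h2 C₁.coe_nonneg)
  have h6 : (C₀ : ℝ≥0∞) = ENNReal.ofReal C₀ := by simp
  rw [h6, ← ENNReal.ofReal_mul (p := (C₀ : ℝ)) C₀.coe_nonneg]
  refine ENNReal.ofReal_le_ofReal ((mul_le_mul_of_nonneg_left h5 C₀.coe_nonneg).trans_eq ?_)
  ring

theorem norm_sub_latticePt_le {k : Fin n → ℤ} {ξ : Eu n} (h : ∀ i, |ξ i - k i| ≤ 1) :
    ‖ξ - latticePt k‖ ≤ Real.sqrt n := by
  rw [EuclideanSpace.norm_eq]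
  refine Real.sqrt_le_sqrt ?_
  calc ∑ i, ‖(ξ - latticePt k) i‖ ^ 2 ≤ ∑ _i : Fin n, (1 : ℝ) := by
        refine Finset.sum_le_sum fun i _ => pow_le_one₀ (norm_nonneg _) ?_
        simpa [latticePt] using h i
    _ = n := by simp

/-- The symbol `m` is supported in the unit box around `k`. -/
def BoxSupported (k : Fin n → ℤ) (m : 𝓢(Eu n, ℂ)) : Prop :=
  ∀ ξ, m ξ ≠ 0 → ∀ i, |ξ i - k i| ≤ 1

theorem BoxSupported.mulS {k : Fin n → ℤ} {m : 𝓢(Eu n, ℂ)} (h : BoxSupported k m)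
    (m' : 𝓢(Eu n, ℂ)) : BoxSupported k (mulS m m') := by
  intro ξ hξ
  refine h ξ fun h0 => hξ ?_
  rw [mulS_apply, h0, zero_mul]

theorem boxSupported_sigmaS (ρ : Window n) (k : Fin n → ℤ) : BoxSupported k (ρ.sigmaS k) :=
  fun _ hξ => ρ.abs_le_of_sigmaS_ne_zero hξ

/-- The radius is `(√n + 1) + √n`: a smooth cut-off equal to `1` on the box at `k` lives within `√n
+ 1` of `k`, and `m₂` lives within `√n` of `l`. -/
theorem integral_mul_eq_zero_of_boxSupported {k l : Fin n → ℤ} {m₁ m₂ θ : 𝓢(Eu n, ℂ)}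
    (h₁ : BoxSupported k m₁) (h₂ : BoxSupported l m₂)
    (hθ : ∀ ξ, ‖ξ - latticePt (k + l)‖ ≤ 2 * Real.sqrt n + 1 → θ ξ = 0) (f g : 𝓢'(Eu n, ℂ)) :
    ∫ x, fourierMul m₁ f x * fourierMul m₂ g x * fourierS n θ x = 0 := by
  obtain ⟨χ, hχ1, hχ0⟩ := exists_cutoff n (Real.sqrt_nonneg n)
  refine integral_fourierMul_mul_fourierMul_eq_zero (a := compSubConstCLM ℂ (latticePt k) χ) f g
    ?_ fun ξ η hη => ?_
  · ext ξ
    rw [mulS_apply, compSubConstCLM_apply]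
    by_cases h0 : m₁ ξ = 0
    · rw [h0, zero_mul]
    · rw [hχ1 _ (norm_sub_latticePt_le (h₁ ξ h0)), mul_one]
  · rw [compSubConstCLM_apply]
    by_cases h0 : Real.sqrt n + 1 ≤ ‖ξ - latticePt k‖
    · rw [hχ0 _ h0, zero_mul]
    · rw [hθ, mul_zero]
      have h3 := norm_sub_latticePt_le (h₂ η hη)
      have h4 : ξ + η - latticePt (k + l) = (ξ - latticePt k) + (η - latticePt l) := by
        rw [Window.latticePt_add]; abel
      rw [h4]
      refine (norm_add_le _ _).trans ?_
      linarith

/-- The available Hölder inequality requires one exponent to exceed `1`; for `p = 1` this role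
passes to the dual exponent `∞`. -/
theorem exists_dual_exponent {p : ℝ≥0∞} (hp : 1 ≤ p) :
    ∃ p' : ℝ≥0∞, ∀ f g : Eu n → ℝ≥0∞, Measurable f → Measurable g →
      ∫⁻ x, f x * g x ≤ eLpNorm f p volume * eLpNorm g p' volume := by
  rcases hp.eq_or_lt with rfl | hp1
  · exact ⟨⊤, fun f g hf hg => lintegral_mul_le_eLpNorm_mul_eLpNorm hf.aemeasurable
      hg.aemeasurable ENNReal.one_lt_top (by simp)⟩
  · refine ⟨(1 - p⁻¹)⁻¹, fun f g hf hg => ?_⟩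
    have h := lintegral_mul_le_eLpNorm_mul_eLpNorm hg.aemeasurable hf.aemeasurable
      (μ := volume) (q := p) (q' := (1 - p⁻¹)⁻¹) hp1 (by
        rw [one_div, one_div, inv_inv]
        exact add_tsub_cancel_of_le (ENNReal.inv_le_one.2 hp))
    rw [mul_comm]
    refine le_trans (le_of_eq ?_) h
    exact lintegral_congr fun x => mul_comm _ _

theorem eLpNorm_mul_le {p p₁ p₂ : ℝ≥0∞} (hpp : 1 / p = 1 / p₁ + 1 / p₂) {u v : Eu n → ℂ}
    (hu : Continuous u) (hv : Continuous v) :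
    eLpNorm (fun x => u x * v x) p volume ≤ eLpNorm u p₁ volume * eLpNorm v p₂ volume := by
  have : ENNReal.HolderTriple p₁ p₂ p := ⟨by simpa using hpp.symm⟩
  have h := eLpNorm_smul_le_mul_eLpNorm (μ := volume) (p := p₁) (q := p₂) (r := p)
    (f := v) (φ := u) hv.aestronglyMeasurable hu.aestronglyMeasurable
  have e : (fun x => u x * v x) = u • v := rfl
  rw [e]
  exact h

/-- `∫ u v F θ` decays rapidly in `k + l` if `u` and `v` have frequencies near `k` and `l`. -/
theorem exists_enorm_integral_mul_le (n : ℕ) {p p₁ p₂ : ℝ≥0∞} (hp : 1 ≤ p)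
    (hpp : 1 / p = 1 / p₁ + 1 / p₂) (N : ℕ) :
    ∃ (C : ℝ) (s : Finset (ℕ × ℕ)), 0 ≤ C ∧ ∀ (k l : Fin n → ℤ) (m₁ m₂ θ : 𝓢(Eu n, ℂ))
      (f g : 𝓢'(Eu n, ℂ)), BoxSupported k m₁ → BoxSupported l m₂ →
      ‖∫ x, fourierMul m₁ f x * fourierMul m₂ g x * fourierS n θ x‖ₑ
        ≤ eLpNorm (fourierMul m₁ f) p₁ volume * eLpNorm (fourierMul m₂ g) p₂ volume *
          ENNReal.ofReal (C * ((1 + ‖latticePt (k + l)‖) ^ N)⁻¹ *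
            s.sup (schwartzSeminormFamily ℂ (Eu n) ℂ) θ) := by
  obtain ⟨p', hp'⟩ := exists_dual_exponent (n := n) hp
  obtain ⟨χ, hχ1, -⟩ := exists_cutoff n (show 0 ≤ 2 * Real.sqrt n + 1 by positivity)
  obtain ⟨C, s, hC, hCs⟩ := exists_eLpNorm_fourierS_cutoff_le χ p' N
  refine ⟨C, s, hC, fun k l m₁ m₂ θ f g h₁ h₂ => ?_⟩
  set u := fourierMul m₁ f
  set v := fourierMul m₂ g
  have hu : Continuous u := continuous_fourierMul m₁ f
  have hv : Continuous v := continuous_fourierMul m₂ g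
  set θ₁ := mulS (compSubConstCLM ℂ (latticePt (k + l)) χ) θ with hθ₁
  -- Only the part of `θ` near `k + l` matters: `θ - θ₁` vanishes on the ball that contains the
  -- spectrum of `u v`.
  have hz : ∫ x, u x * v x * fourierS n (θ - θ₁) x = 0 := by
    refine integral_mul_eq_zero_of_boxSupported h₁ h₂ (fun ξ hξ => ?_) f g
    rw [sub_apply, hθ₁, mulS_apply, compSubConstCLM_apply, hχ1 _ hξ, one_mul, sub_self]
  have he : ∫ x, u x * v x * fourierS n θ x = ∫ x, u x * v x * fourierS n θ₁ x := by
    rw [← sub_eq_zero, ← integral_sub (integrable_fourierMul_mul_mul _ _ _ _ _)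
      (integrable_fourierMul_mul_mul _ _ _ _ _), ← hz]
    refine integral_congr_ae (ae_of_all _ fun x => ?_)
    simp only [map_sub, sub_apply]
    ring
  rw [he]
  calc ‖∫ x, u x * v x * fourierS n θ₁ x‖ₑ
      ≤ ∫⁻ x, ‖u x * v x‖ₑ * ‖fourierS n θ₁ x‖ₑ := by
        refine (enorm_integral_le_lintegral_enorm _).trans_eq ?_
        simp only [enorm_mul]
    _ ≤ eLpNorm (fun x => ‖u x * v x‖ₑ) p volume *
          eLpNorm (fun x => ‖fourierS n θ₁ x‖ₑ) p' volume :=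
        hp' _ _ (hu.mul hv).enorm.measurable (fourierS n θ₁).continuous.enorm.measurable
    _ = eLpNorm (fun x => u x * v x) p volume * eLpNorm (fourierS n θ₁) p' volume := by
        rw [eLpNorm_enorm, eLpNorm_enorm]
    _ ≤ _ := mul_le_mul' (eLpNorm_mul_le hpp hu hv) (hCs _ _)

/-! ### Sums over the orthant -/

/-- Coordinates of equal sign cannot cancel. This is where it matters that `f` and `g` live in the
same orthant. -/
theorem abs_add_abs_of_mem_orthantLattice {ε : Fin n → Fin 2} {R : ℝ} {k l : Fin n → ℤ}
    (hk : k ∈ orthantLattice ε R) (hl : l ∈ orthantLattice ε R) (i : Fin n) :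
    |(k i : ℝ)| + |(l i : ℝ)| = |((k i + l i : ℤ) : ℝ)| := by
  have h1 := hk.1 i
  have h2 := hl.1 i
  rcases Fin.exists_fin_two.1 ⟨ε i, rfl⟩ with h | h
  · rw [h] at h1 h2
    simp only [Fin.val_zero, pow_zero, one_mul] at h1 h2
    have h3 : |k i| + |l i| = |k i + l i| := by
      rw [abs_of_nonneg h1, abs_of_nonneg h2, abs_of_nonneg (by omega)]
    exact_mod_cast h3
  · rw [h] at h1 h2
    simp only [Fin.val_one, pow_one, neg_mul, one_mul] at h1 h2
    have h3 : |k i| + |l i| = |k i + l i| := by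
      rw [abs_of_nonpos (by omega), abs_of_nonpos (by omega), abs_of_nonpos (by omega)]
      omega
    exact_mod_cast h3

/-- A summable weight on pairs of lattice points. -/
def pairWeight (z : (Fin n → ℤ) × (Fin n → ℤ)) : ℝ :=
  ((1 + ‖z.1‖) ^ (n + 1))⁻¹ * ((1 + ‖z.2‖) ^ (n + 1))⁻¹

theorem summable_pairWeight (n : ℕ) : Summable (pairWeight (n := n)) := by
  have h : Summable fun a : Fin n → ℤ => ((1 + ‖a‖) ^ (n + 1))⁻¹ := by
    have h1 := summable_norm_rpow_int (n := n) (t := (n + 1 : ℕ)) (by push_cast; linarith)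
    refine h1.of_norm_bounded_eventually ?_
    -- The comparison fails exactly at the origin, where the right side is `0` by convention.
    refine (Set.finite_singleton (0 : Fin n → ℤ)).subset fun a ha => ?_
    by_contra h0
    refine ha ?_
    have hpos : 0 < ‖a‖ := norm_pos_iff.2 h0
    change ‖((1 + ‖a‖) ^ (n + 1))⁻¹‖ ≤ ‖a‖ ^ (-((n + 1 : ℕ) : ℝ))
    rw [Real.norm_of_nonneg (by positivity), Real.rpow_neg (norm_nonneg _), Real.rpow_natCast]
    refine inv_anti₀ (by positivity) ?_
    exact pow_le_pow_left₀ (norm_nonneg _) (by linarith) _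
  exact h.mul_of_nonneg h (fun _ => by positivity) (fun _ => by positivity)

/-- Both `k` and `l` are dominated by `k + l`, so the exponent `2(n + 1)` can be shared equally;
each half exceeds `n`, which gives summability over pairs. -/
theorem inv_pow_le_pairWeight {ε : Fin n → Fin 2} {R : ℝ} {k l : Fin n → ℤ}
    (hk : k ∈ orthantLattice ε R) (hl : l ∈ orthantLattice ε R) :
    ((1 + ‖latticePt (k + l)‖) ^ (2 * (n + 1)))⁻¹ ≤ pairWeight (k, l) := by
  have h1 : ‖k‖ ≤ ‖latticePt (k + l)‖ := by
    refine (pi_norm_le_iff_of_nonneg (norm_nonneg _)).2 fun i => ?_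
    rw [Int.norm_eq_abs]
    have := abs_add_abs_of_mem_orthantLattice hk hl i
    have h2 := norm_apply_le_norm_latticePt (k + l) i
    rw [Pi.add_apply, ← this] at h2
    linarith [abs_nonneg (l i : ℝ)]
  have h2 : ‖l‖ ≤ ‖latticePt (k + l)‖ := by
    refine (pi_norm_le_iff_of_nonneg (norm_nonneg _)).2 fun i => ?_
    rw [Int.norm_eq_abs]
    have := abs_add_abs_of_mem_orthantLattice hk hl i
    have h2 := norm_apply_le_norm_latticePt (k + l) i
    rw [Pi.add_apply, ← this] at h2
    linarith [abs_nonneg (k i : ℝ)]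
  rw [pairWeight, ← mul_inv]
  refine inv_anti₀ (by positivity) ?_
  rw [two_mul, pow_add (1 + ‖latticePt (k + l)‖)]
  have h3 : ∀ t : ℝ, 0 ≤ t → t ≤ ‖latticePt (k + l)‖ →
      (1 + t) ^ (n + 1) ≤ (1 + ‖latticePt (k + l)‖) ^ (n + 1) :=
    fun t ht h => pow_le_pow_left₀ (by linarith) (by linarith) _
  exact mul_le_mul (h3 _ (norm_nonneg _) h1) (h3 _ (norm_nonneg _) h2) (by positivity)
    (by positivity)

/-! ### Existence of the product. -/

theorem box_eq_zero_fun (ρ : Window n) {ε : Fin n → Fin 2} {R : ℝ} {f : 𝓢'(Eu n, ℂ)}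
    (hf : Distribution.dsupport (fourierD f) ⊆ orthantPiece ε R) {k : Fin n → ℤ}
    (hk : k ∉ orthantLattice ε R) (m : 𝓢(Eu n, ℂ)) (x : Eu n) :
    fourierMul (mulS (ρ.sigmaS k) m) f x = 0 := by
  rw [fourierMul_mulS]
  have : ∀ y, fourierMul (ρ.sigmaS k) f y = 0 := box_eq_zero ρ hf hk
  simp [this]

/-- `ℓ^q` embeds in `ℓ^∞`, and `⟨k⟩^s ≥ 1` because `s ≥ 0`. -/
theorem exists_le_of_modSpace (ρ : Window n) {p q : ℝ≥0∞} {s : ℝ} (hs : 0 ≤ s) (hq : q ≠ 0)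
    {f : 𝓢'(Eu n, ℂ)} (hf : f ∈ modSpace ρ p q s) :
    ∃ A : ℝ, 0 ≤ A ∧ ∀ k, eLpNorm (ρ.box k f) p volume ≤ ENNReal.ofReal A := by
  have hf' : modNorm ρ p q s f ≠ ⊤ := ne_of_lt hf
  refine ⟨(modNorm ρ p q s f).toReal, ENNReal.toReal_nonneg, fun k => ?_⟩
  rw [ENNReal.ofReal_toReal hf']
  have h1 : eLpNorm (ρ.box k f) p volume
      ≤ ENNReal.ofReal (bracket (latticePt k) ^ s) * eLpNorm (ρ.box k f) p volume := by
    refine le_mul_of_one_le_left zero_le ?_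
    rw [ENNReal.one_le_ofReal]
    exact Real.one_le_rpow (one_le_bracket _) hs
  refine h1.trans ?_
  rw [modNorm]
  set w : (Fin n → ℤ) → ℝ≥0∞ := fun k =>
    ENNReal.ofReal (bracket (latticePt k) ^ s) * eLpNorm (ρ.box k f) p volume
  change w k ≤ eLpNorm w q Measure.count
  rcases eq_or_ne q ⊤ with rfl | hq_top
  · rw [eLpNorm_exponent_top]
    have h := enorm_ae_le_eLpNormEssSup w (Measure.count : Measure (Fin n → ℤ))
    rw [Measure.ae_count_iff] at h
    exact h k
  · have hq0 : 0 < q.toReal := ENNReal.toReal_pos hq hq_top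
    rw [eLpNorm_eq_lintegral_rpow_enorm_toReal hq hq_top, lintegral_count]
    calc w k = (w k ^ q.toReal) ^ (1 / q.toReal) := by
          rw [← ENNReal.rpow_mul, mul_one_div_cancel hq0.ne', ENNReal.rpow_one]
      _ ≤ _ := ENNReal.rpow_le_rpow (ENNReal.le_tsum (f := fun k => ‖w k‖ₑ ^ q.toReal) k)
          (by positivity)

theorem mulS_sum {ι : Type*} (S : Finset ι) (a : ι → 𝓢(Eu n, ℂ)) (b : 𝓢(Eu n, ℂ)) :
    ∑ i ∈ S, mulS (a i) b = mulS (∑ i ∈ S, a i) b := by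
  ext ξ
  simp only [sum_apply, mulS_apply, Finset.sum_mul]

theorem fourierMul_sum {ι : Type*} (S : Finset ι) (m : ι → 𝓢(Eu n, ℂ)) (f : 𝓢'(Eu n, ℂ))
    (x : Eu n) : fourierMul (∑ i ∈ S, m i) f x = ∑ i ∈ S, fourierMul (m i) f x := by
  simp only [fourierMul, map_sum, Finset.mul_sum]

theorem fourierMul_zero (f : 𝓢'(Eu n, ℂ)) (x : Eu n) : fourierMul 0 f x = 0 := by
  simp [fourierMul]

/-- A compactly supported symbol is a finite sum of its pieces. -/
theorem exists_finset_sum_mulS (ρ : Window n) {m : 𝓢(Eu n, ℂ)} (hm : HasCompactSupport m) :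
    ∃ S : Finset (Fin n → ℤ), m = ∑ k ∈ S, mulS (ρ.sigmaS k) m ∧
      ∀ k ∉ S, mulS (ρ.sigmaS k) m = 0 := by
  obtain ⟨r, hr⟩ := hm.isCompact.isBounded.exists_norm_le
  have hr' : ∀ ξ, m ξ ≠ 0 → ∀ i, |ξ i| ≤ r := fun ξ hξ i =>
    (by simpa using PiLp.norm_apply_le ξ i : |ξ i| ≤ ‖ξ‖).trans (hr ξ (subset_tsupport _ hξ))
  let S : Finset (Fin n → ℤ) := Fintype.piFinset fun _ => Finset.Icc (-⌈r + 1⌉) ⌈r + 1⌉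
  have hS : ∀ ξ, m ξ ≠ 0 → ∀ k : Fin n → ℤ, (∀ i, |ξ i - k i| ≤ 1) → k ∈ S := by
    intro ξ hξ k hk
    refine Fintype.mem_piFinset.2 fun i => Finset.mem_Icc.2 ?_
    have h1 := abs_le.1 (hr' ξ hξ i)
    have h2 := abs_le.1 (hk i)
    have h3 := Int.le_ceil (r + 1)
    constructor
    · have : (-⌈r + 1⌉ : ℝ) ≤ k i := by linarith
      exact_mod_cast this
    · have : (k i : ℝ) ≤ ⌈r + 1⌉ := by linarith
      exact_mod_cast this
  refine ⟨S, ?_, fun k hk => ?_⟩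
  · rw [mulS_sum]
    ext ξ
    rw [mulS_apply, sum_apply]
    by_cases hξ : m ξ = 0
    · rw [hξ, mul_zero]
    · rw [ρ.sum_sigmaS (hS ξ hξ), one_mul]
  · ext ξ
    rw [mulS_apply]
    change _ = (0 : ℂ)
    by_contra h
    exact hk (hS ξ (right_ne_zero_of_mul h) k (ρ.abs_le_of_sigmaS_ne_zero (left_ne_zero_of_mul h)))

/-- Uniform bound for the terms of the product of two distributions with frequencies in the same
orthant. -/
theorem exists_norm_term_le (n : ℕ) {p p₁ p₂ : ℝ≥0∞} (hp : 1 ≤ p)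
    (hpp : 1 / p = 1 / p₁ + 1 / p₂) :
    ∃ (C : ℝ) (s : Finset (ℕ × ℕ)), 0 ≤ C ∧ ∀ (ε : Fin n → Fin 2) (R A B : ℝ),
      0 ≤ A → 0 ≤ B → ∀ (f g : 𝓢'(Eu n, ℂ)),
      ∀ (M : (Fin n → ℤ) → 𝓢(Eu n, ℂ)) (θ : 𝓢(Eu n, ℂ)), (∀ k, BoxSupported k (M k)) →
      (∀ k ∉ orthantLattice ε R, ∀ x, fourierMul (M k) f x = 0) →
      (∀ k ∉ orthantLattice ε R, ∀ x, fourierMul (M k) g x = 0) →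
      (∀ k, eLpNorm (fourierMul (M k) f) p₁ volume ≤ ENNReal.ofReal A) →
      (∀ k, eLpNorm (fourierMul (M k) g) p₂ volume ≤ ENNReal.ofReal B) →
      ∀ z : (Fin n → ℤ) × (Fin n → ℤ),
        ‖∫ x, fourierMul (M z.1) f x * fourierMul (M z.2) g x * fourierS n θ x‖
          ≤ A * B * C * s.sup (schwartzSeminormFamily ℂ (Eu n) ℂ) θ * pairWeight z := by
  obtain ⟨C, s, hC, h⟩ := exists_enorm_integral_mul_le n hp hpp (2 * (n + 1))
  refine ⟨C, s, hC, fun ε R A B hA hB f g M θ hM hf hg hfA hgB z => ?_⟩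
  have hT : 0 ≤ s.sup (schwartzSeminormFamily ℂ (Eu n) ℂ) θ := apply_nonneg _ _
  have hW : 0 ≤ pairWeight z := by
    rw [pairWeight]
    positivity
  by_cases h1 : z.1 ∈ orthantLattice ε R
  · by_cases h2 : z.2 ∈ orthantLattice ε R
    · have h3 := h z.1 z.2 _ _ θ f g (hM z.1) (hM z.2)
      rw [← ofReal_norm] at h3
      have h4 := h3.trans (mul_le_mul' (mul_le_mul' (hfA z.1) (hgB z.2)) (ENNReal.ofReal_le_ofReal
        (mul_le_mul_of_nonneg_right (mul_le_mul_of_nonneg_left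
          (inv_pow_le_pairWeight h1 h2) hC) hT)))
      rw [← ENNReal.ofReal_mul hA, ← ENNReal.ofReal_mul (by positivity),
        ENNReal.ofReal_le_ofReal_iff (by positivity)] at h4
      refine h4.trans_eq ?_
      ring
    · simp only [hg _ h2, mul_zero, zero_mul, integral_zero, norm_zero]
      positivity
  · simp only [hf _ h1, zero_mul, integral_zero, norm_zero]
    positivity

/-- The box at `k` lies in the ball of radius `|k| + √n`, which the dilation shrinks into the
neighbourhood where `ψ = 1`. -/
theorem eventually_mulS_dilate (ρ : Window n) {ψ : 𝓢(Eu n, ℂ)} (hψ : ∀ᶠ ξ in 𝓝 0, ψ ξ = 1)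
    (k : Fin n → ℤ) : ∀ᶠ j : ℕ in atTop,
      mulS (ρ.sigmaS k) (dilate ((2 : ℝ) ^ j)⁻¹ (by positivity) ψ) = ρ.sigmaS k := by
  obtain ⟨δ, hδ, h⟩ := Metric.eventually_nhds_iff.1 hψ
  have hlim : Tendsto (fun j : ℕ => ((2 : ℝ) ^ j)⁻¹ * (‖latticePt k‖ + Real.sqrt n)) atTop (𝓝 0) := by
    have h1 : Tendsto (fun j : ℕ => ((2 : ℝ) ^ j)⁻¹) atTop (𝓝 0) :=
      (tendsto_pow_atTop_atTop_of_one_lt one_lt_two).inv_tendsto_atTop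
    simpa using h1.mul_const (‖latticePt k‖ + Real.sqrt n)
  filter_upwards [hlim.eventually (gt_mem_nhds hδ)] with j hj
  ext ξ
  rw [mulS_apply, dilate_apply]
  by_cases h0 : ρ.sigmaS k ξ = 0
  · rw [h0, zero_mul]
  · rw [h, mul_one]
    rw [dist_zero_right, norm_smul, Real.norm_of_nonneg (by positivity)]
    refine lt_of_le_of_lt (mul_le_mul_of_nonneg_left ?_ (by positivity)) hj
    have h1 := norm_sub_latticePt_le (ρ.abs_le_of_sigmaS_ne_zero h0)
    have h2 := norm_add_le (ξ - latticePt k) (latticePt k)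
    rw [sub_add_cancel] at h2
    linarith

theorem hasCompactSupport_dilate {a : ℝ} (ha : a ≠ 0) {ψ : 𝓢(Eu n, ℂ)} (hψ : HasCompactSupport ψ) :
    HasCompactSupport (dilate a ha ψ) :=
  hψ.comp_homeomorph (Homeomorph.smulOfNeZero a ha)

/-- A dominated series of linear functionals on Schwartz functions defines a distribution. -/
theorem exists_distribution_of_norm_le {ι : Type*} (T : 𝓢(Eu n, ℂ) → ι → ℂ)
    (hadd : ∀ φ φ' z, T (φ + φ') z = T φ z + T φ' z) (hsmul : ∀ (a : ℂ) φ z, T (a • φ) z = a * T φ z)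
    (s : Finset (ℕ × ℕ)) {C : ℝ} (hC : 0 ≤ C) {w : ι → ℝ} (hw : Summable w) (hw0 : ∀ z, 0 ≤ w z)
    (hT : ∀ φ z, ‖T (fourierS n φ) z‖ ≤ C * s.sup (schwartzSeminormFamily ℂ (Eu n) ℂ) φ * w z) :
    ∃ h : 𝓢'(Eu n, ℂ), ∀ φ, HasSum (T φ) (h φ) := by
  have hsum : ∀ φ, Summable (T φ) := by
    intro φ
    rw [← fourierS_fourierSInv φ]
    exact Summable.of_norm_bounded (hw.mul_left _) (hT _)
  have hbound : ∀ φ, ‖∑' z, T (fourierS n φ) z‖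
      ≤ (C * ∑' z, w z) * s.sup (schwartzSeminormFamily ℂ (Eu n) ℂ) φ := by
    intro φ
    refine (tsum_of_norm_bounded (hw.mul_left _).hasSum (hT φ)).trans_eq ?_
    rw [tsum_mul_left]
    ring
  -- The bounds are in terms of `θ`, not of `F θ`; so the functional is first built in the variable
  -- `θ` and then composed with the inverse transform.
  have hlin : ∃ h₁ : 𝓢(Eu n, ℂ) →L[ℂ] ℂ, ∀ θ, h₁ θ = ∑' z, T (fourierS n θ) z :=
    ⟨mkCLMtoNormedSpace (σ := RingHom.id ℂ)
      (fun θ => ∑' z, T (fourierS n θ) z)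
      (fun θ θ' => by
        rw [← (hsum _).tsum_add (hsum _)]
        exact tsum_congr fun z => by rw [map_add, hadd])
      (fun a θ => by
        rw [RingHom.id_apply, smul_eq_mul, ← tsum_mul_left]
        exact tsum_congr fun z => by rw [map_smul, hsmul])
      ⟨s, C * ∑' z, w z, mul_nonneg hC (tsum_nonneg hw0), hbound⟩, fun θ => rfl⟩
  obtain ⟨h₁, hh₁⟩ := hlin
  refine ⟨ContinuousLinearMap.toPointwiseConvergenceCLM _ _ _ _ (h₁ ∘L fourierSInv n), fun φ => ?_⟩
  have e : ContinuousLinearMap.toPointwiseConvergenceCLM _ _ _ _ (h₁ ∘L fourierSInv n) φ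
      = h₁ (fourierSInv n φ) := rfl
  rw [e, hh₁, fourierS_fourierSInv]
  exact (hsum φ).hasSum

theorem eLpNorm_fourierMul_mulS_dilate_le (ρ : Window n) (ψ : 𝓢(Eu n, ℂ)) {r : ℝ≥0∞} (hr : 1 ≤ r)
    {F : 𝓢'(Eu n, ℂ)} {K : ℝ} (hK : ∀ k, eLpNorm (ρ.box k F) r volume ≤ ENNReal.ofReal K)
    (a : ℝ) (ha : a ≠ 0) (k : Fin n → ℤ) :
    eLpNorm (fourierMul (mulS (ρ.sigmaS k) (dilate a ha ψ)) F) r volume ≤ ENNReal.ofReal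
      ((ENNReal.ofReal (normFactor n) * eLpNorm (fourierS n ψ) 1 volume).toReal * K) := by
  have hDtop : ENNReal.ofReal (normFactor n) * eLpNorm (fourierS n ψ) 1 volume ≠ ⊤ :=
    ENNReal.mul_ne_top ENNReal.ofReal_ne_top ((fourierS n ψ).memLp 1 volume).eLpNorm_ne_top
  refine (eLpNorm_fourierMul_mulS_le _ _ F hr).trans ?_
  rw [eLpNorm_fourierS_dilate, ENNReal.ofReal_mul ENNReal.toReal_nonneg,
    ENNReal.ofReal_toReal hDtop]
  exact mul_le_mul_right (hK k) _

/-- For a compactly supported symbol the series has finitely many nonzero terms; it is written as an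
infinite sum so that dominated convergence applies. -/
theorem integral_fourierMul_mul_fourierMul_eq_tsum (ρ : Window n) {m : 𝓢(Eu n, ℂ)}
    (hm : HasCompactSupport m) (f g : 𝓢'(Eu n, ℂ)) (φ : 𝓢(Eu n, ℂ)) :
    ∫ x, fourierMul m f x * fourierMul m g x * φ x = ∑' z : (Fin n → ℤ) × (Fin n → ℤ),
      ∫ x, fourierMul (mulS (ρ.sigmaS z.1) m) f x * fourierMul (mulS (ρ.sigmaS z.2) m) g x
        * φ x := by
  obtain ⟨S, hS, hS0⟩ := exists_finset_sum_mulS ρ hm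
  have e : ∀ (F : 𝓢'(Eu n, ℂ)) x,
      fourierMul m F x = ∑ k ∈ S, fourierMul (mulS (ρ.sigmaS k) m) F x := by
    intro F x
    rw [← fourierMul_sum, ← hS]
  rw [tsum_eq_sum (s := S ×ˢ S)]
  · rw [← integral_finsetSum _ fun z _ => integrable_fourierMul_mul_mul _ _ φ f g]
    refine integral_congr_ae (ae_of_all _ fun x => ?_)
    simp only
    rw [e f, e g, Finset.sum_mul_sum, ← Finset.sum_product', Finset.sum_mul]
  · intro z hz
    rw [Finset.mem_product, not_and_or] at hz
    rcases hz with hz | hz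
    · simp [hS0 _ hz, fourierMul_zero]
    · simp [hS0 _ hz, fourierMul_zero]

/-- The product of two distributions with frequencies in the same orthant exists. -/
theorem exists_product (ρ : Window n) {p p₁ p₂ q : ℝ≥0∞} {s₁ s₂ : ℝ} (hp : 1 ≤ p) (hp₁ : 1 ≤ p₁)
    (hp₂ : 1 ≤ p₂) (hpp : 1 / p = 1 / p₁ + 1 / p₂) (hq : q ≠ 0) (hs₁ : 0 ≤ s₁) (hs₂ : 0 ≤ s₂)
    {ε : Fin n → Fin 2} {R : ℝ} {f g : 𝓢'(Eu n, ℂ)} (hf : f ∈ modSpaceOrthant ρ p₁ q s₁ ε R)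
    (hg : g ∈ modSpaceOrthant ρ p₂ q s₂ ε R) :
    ∃ h : 𝓢'(Eu n, ℂ), IsProduct f g h ∧ ∀ φ : 𝓢(Eu n, ℂ),
      HasSum (fun z : (Fin n → ℤ) × (Fin n → ℤ) =>
        ∫ x, ρ.box z.1 f x * ρ.box z.2 g x * φ x) (h φ) := by
  obtain ⟨C, s, hC, hterm⟩ := exists_norm_term_le n hp hpp
  obtain ⟨A, hA, hfA⟩ := exists_le_of_modSpace ρ hs₁ hq hf.1
  obtain ⟨B, hB, hgB⟩ := exists_le_of_modSpace ρ hs₂ hq hg.1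
  have hWs := summable_pairWeight n
  have hint : ∀ (z : (Fin n → ℤ) × (Fin n → ℤ)) (φ : 𝓢(Eu n, ℂ)),
      Integrable fun x => ρ.box z.1 f x * ρ.box z.2 g x * φ x :=
    fun z φ => integrable_fourierMul_mul_mul _ _ φ f g
  obtain ⟨h, hh⟩ := exists_distribution_of_norm_le
    (fun (φ : 𝓢(Eu n, ℂ)) (z : (Fin n → ℤ) × (Fin n → ℤ)) =>
      ∫ x, ρ.box z.1 f x * ρ.box z.2 g x * φ x)
    (fun φ φ' z => by
      simp only [add_apply, mul_add]
      exact integral_add (hint z _) (hint z _))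
    (fun a φ z => by
      rw [← integral_const_mul]
      refine integral_congr_ae (ae_of_all _ fun x => ?_)
      simp only [smul_apply, smul_eq_mul]
      ring)
    s (C := A * B * C) (by positivity) hWs (fun z => by rw [pairWeight]; positivity)
    (fun θ z => hterm ε R A B hA hB f g ρ.sigmaS θ (boxSupported_sigmaS ρ)
      (fun k hk => box_eq_zero ρ hf.2 hk) (fun k hk => box_eq_zero ρ hg.2 hk) hfA hgB z)
  refine ⟨h, fun ψ hψc hψ φ => ?_, hh⟩
  rw [← (hh φ).tsum_eq]
  have hlow : ∀ j : ℕ, ∫ x, lowPass ψ j f x * lowPass ψ j g x * φ x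
      = ∑' z : (Fin n → ℤ) × (Fin n → ℤ), ∫ x,
        fourierMul (mulS (ρ.sigmaS z.1) (dilate ((2 : ℝ) ^ j)⁻¹ (by positivity) ψ)) f x *
        fourierMul (mulS (ρ.sigmaS z.2) (dilate ((2 : ℝ) ^ j)⁻¹ (by positivity) ψ)) g x * φ x :=
    fun j => integral_fourierMul_mul_fourierMul_eq_tsum ρ
      (hasCompactSupport_dilate (by positivity) hψc) f g φ
  simp only [hlow]
  set D : ℝ := (ENNReal.ofReal (normFactor n) * eLpNorm (fourierS n ψ) 1 volume).toReal with hD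
  have hD0 : 0 ≤ D := ENNReal.toReal_nonneg
  -- Each term is eventually constant in `j`, and the majorant is free of `j`: the cut-off only
  -- replaces `A`, `B` by `D * A`, `D * B`.
  refine tendsto_tsum_of_dominated_convergence (hWs.mul_left ((D * A) * (D * B) * C *
    s.sup (schwartzSeminormFamily ℂ (Eu n) ℂ) (fourierSInv n φ))) (fun z => ?_)
    (Eventually.of_forall fun j z => ?_)
  · refine tendsto_const_nhds.congr' ?_
    filter_upwards [eventually_mulS_dilate ρ hψ z.1, eventually_mulS_dilate ρ hψ z.2] with j h1 h2
    rw [h1, h2]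
    rfl
  · have := hterm ε R (D * A) (D * B) (by positivity) (by positivity) f g
      (fun k => mulS (ρ.sigmaS k) (dilate ((2 : ℝ) ^ j)⁻¹ (by positivity) ψ)) (fourierSInv n φ)
      (fun k => (boxSupported_sigmaS ρ k).mulS _)
      (fun k hk => box_eq_zero_fun ρ hf.2 hk _) (fun k hk => box_eq_zero_fun ρ hg.2 hk _)
      (eLpNorm_fourierMul_mulS_dilate_le ρ ψ hp₁ hfA _ (by positivity))
      (eLpNorm_fourierMul_mulS_dilate_le ρ ψ hp₂ hgB _ (by positivity)) z
    rwa [fourierS_fourierSInv] at this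

/-! ### The decomposition of the product -/

theorem finite_latticePt_le (n : ℕ) (D : ℝ) : {r : Fin n → ℤ | ‖latticePt r‖ ≤ D}.Finite := by
  refine (Set.finite_Icc (fun _ : Fin n => -⌈D⌉) (fun _ => ⌈D⌉)).subset fun r hr => ?_
  have key : ∀ i, |r i| ≤ ⌈D⌉ := fun i => by
    have := ((norm_apply_le_norm_latticePt r i).trans hr).trans (Int.le_ceil D)
    exact_mod_cast this
  exact ⟨fun i => (abs_le.1 (key i)).1, fun i => (abs_le.1 (key i)).2⟩

/-- The lattice points `r` with `|r| ≤ 3 √n + 1`. -/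
def nearOrigin (n : ℕ) : Finset (Fin n → ℤ) := (finite_latticePt_le n (3 * Real.sqrt n + 1)).toFinset

theorem mem_nearOrigin {r : Fin n → ℤ} :
    r ∈ nearOrigin n ↔ ‖latticePt r‖ ≤ 3 * Real.sqrt n + 1 := by
  simp [nearOrigin]

/-- The spectrum of the product lies within `2√n + 1` of `k + l` and `σ_m` lives within `√n` of `m`;
the sum of these radii defines `nearOrigin`. -/
theorem integral_box_mul_box_eq_zero (ρ : Window n) {k l m : Fin n → ℤ}
    (h : k + l - m ∉ nearOrigin n) (f g : 𝓢'(Eu n, ℂ)) (x : Eu n) :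
    ∫ y, ρ.box k f y * ρ.box l g y * compSubConstCLM ℂ x (fourierS n (ρ.sigmaS m)) y = 0 := by
  rw [compSubConst_fourierS]
  refine integral_mul_eq_zero_of_boxSupported (boxSupported_sigmaS ρ k) (boxSupported_sigmaS ρ l)
    (fun ξ hξ => ?_) f g
  rw [smulLeftCLM_apply_apply (character_hasTemperateGrowth x)]
  by_cases h0 : ρ.sigmaS m ξ = 0
  · rw [h0, smul_zero]
  · exfalso
    refine h (mem_nearOrigin.2 ?_)
    have h1 := norm_sub_latticePt_le (ρ.abs_le_of_sigmaS_ne_zero h0)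
    have h2 : latticePt (k + l - m) = (ξ - latticePt m) - (ξ - latticePt (k + l)) := by
      rw [Window.latticePt_sub]; abel
    rw [h2]
    refine (norm_sub_le _ _).trans ?_
    linarith

/-- With `r = k + l - m` near the origin, `|l i| ≤ |k + l| ≤ |m| + 3√n + 1` because nothing cancels.
So only finitely many pairs contribute for each `m`. -/
theorem exists_box_eq_sum (ρ : Window n) {ε : Fin n → Fin 2} {R : ℝ} {f g h : 𝓢'(Eu n, ℂ)}
    (hf : Distribution.dsupport (fourierD f) ⊆ orthantPiece ε R)
    (hg : Distribution.dsupport (fourierD g) ⊆ orthantPiece ε R)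
    (hh : ∀ φ : 𝓢(Eu n, ℂ), HasSum (fun z : (Fin n → ℤ) × (Fin n → ℤ) =>
      ∫ x, ρ.box z.1 f x * ρ.box z.2 g x * φ x) (h φ)) (m : Fin n → ℤ) :
    ∃ L : Finset (Fin n → ℤ), ∀ x, ρ.box m h x = (normFactor n : ℂ) *
      ∑ w ∈ nearOrigin n ×ˢ L, ∫ y, ρ.box (m + w.1 - w.2) f y * ρ.box w.2 g y *
        fourierS n (ρ.sigmaS m) (y - x) := by
  let D : ℝ := ‖latticePt m‖ + (3 * Real.sqrt n + 1)
  let L : Finset (Fin n → ℤ) := Finset.Icc (fun _ => -⌈D⌉) (fun _ => ⌈D⌉)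
  refine ⟨L, fun x => ?_⟩
  rw [Window.box, fourierMul_eq]
  congr 1
  have hinj : Set.InjOn (fun w : (Fin n → ℤ) × (Fin n → ℤ) => (m + w.1 - w.2, w.2))
      (nearOrigin n ×ˢ L : Finset _) := by
    rintro ⟨r, l⟩ - ⟨r', l'⟩ - h
    simp only [Prod.mk.injEq] at h
    obtain ⟨h1, rfl⟩ := h
    simpa using h1
  have h1 := (hh (compSubConstCLM ℂ x (fourierS n (ρ.sigmaS m)))).unique (hasSum_sum_of_ne_finset_zero
    (s := (nearOrigin n ×ˢ L).image fun w : (Fin n → ℤ) × (Fin n → ℤ) => (m + w.1 - w.2, w.2)) ?_)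
  · rw [h1, Finset.sum_image hinj]
    rfl
  · rintro ⟨k, l⟩ hz
    by_cases hk : k ∈ orthantLattice ε R
    swap
    · simp [box_eq_zero ρ hf hk]
    by_cases hl : l ∈ orthantLattice ε R
    swap
    · simp [box_eq_zero ρ hg hl]
    refine integral_box_mul_box_eq_zero ρ (fun hr => hz ?_) f g x
    refine Finset.mem_image.2 ⟨(k + l - m, l), Finset.mem_product.2 ⟨hr, ?_⟩, ?_⟩
    · have key : ∀ i, |l i| ≤ ⌈D⌉ := fun i => by
        have h2 := abs_add_abs_of_mem_orthantLattice hk hl i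
        have h3 := norm_apply_le_norm_latticePt (k + l) i
        have h4 : latticePt (k + l) = latticePt m + latticePt (k + l - m) := by
          rw [Window.latticePt_sub]; abel
        have h5 := norm_add_le (latticePt m) (latticePt (k + l - m))
        rw [← h4] at h5
        rw [Pi.add_apply, ← h2] at h3
        have h6 : |(l i : ℝ)| ≤ ⌈D⌉ := by
          refine le_trans ?_ (Int.le_ceil D)
          have := mem_nearOrigin.1 hr
          have := abs_nonneg (k i : ℝ)
          change _ ≤ ‖latticePt m‖ + (3 * Real.sqrt n + 1)
          linarith
        exact_mod_cast h6
      exact Finset.mem_Icc.2 ⟨fun i => (abs_le.1 (key i)).1, fun i => (abs_le.1 (key i)).2⟩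
    · ext i <;> simp

/-- Young for the kernel of `σ_m`, whose `L¹` norm is that for `m = 0`, then Hölder for each pair.
Extending the finite range of `l` to the whole lattice removes its dependence on `m`. -/
theorem eLpNorm_box_le (ρ : Window n) {p p₁ p₂ : ℝ≥0∞} (hp : 1 ≤ p)
    (hpp : 1 / p = 1 / p₁ + 1 / p₂) {ε : Fin n → Fin 2} {R : ℝ} {f g h : 𝓢'(Eu n, ℂ)}
    (hf : Distribution.dsupport (fourierD f) ⊆ orthantPiece ε R)
    (hg : Distribution.dsupport (fourierD g) ⊆ orthantPiece ε R)
    (hh : ∀ φ : 𝓢(Eu n, ℂ), HasSum (fun z : (Fin n → ℤ) × (Fin n → ℤ) =>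
      ∫ x, ρ.box z.1 f x * ρ.box z.2 g x * φ x) (h φ)) (m : Fin n → ℤ) :
    eLpNorm (ρ.box m h) p volume
      ≤ ENNReal.ofReal (normFactor n) * eLpNorm (fourierS n (ρ.sigmaS 0)) 1 volume *
        ∑ r ∈ nearOrigin n, ∑' l : Fin n → ℤ,
          eLpNorm (ρ.box (m + r - l) f) p₁ volume * eLpNorm (ρ.box l g) p₂ volume := by
  obtain ⟨L, hL⟩ := exists_box_eq_sum ρ hf hg hh m
  set K := fourierS n (ρ.sigmaS m) with hK
  set G : (Fin n → ℤ) × (Fin n → ℤ) → Eu n → ℂ := fun w x =>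
    ∫ y, ρ.box (m + w.1 - w.2) f y * ρ.box w.2 g y * K (y - x) with hG
  have hGle : ∀ w, eLpNorm (G w) p volume ≤ eLpNorm K 1 volume *
      (eLpNorm (ρ.box (m + w.1 - w.2) f) p₁ volume * eLpNorm (ρ.box w.2 g) p₂ volume) := by
    intro w
    have hu : Continuous (ρ.box (m + w.1 - w.2) f) := continuous_fourierMul _ _
    have hv : Continuous (ρ.box w.2 g) := continuous_fourierMul _ _
    refine (eLpNorm_integral_kernel_le K (hu.mul hv) hp).trans ?_
    exact mul_le_mul_right (eLpNorm_mul_le hpp hu hv) _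
  have hGm : ∀ w, AEStronglyMeasurable (G w) volume := by
    intro w
    have hu : Continuous (ρ.box (m + w.1 - w.2) f) := continuous_fourierMul _ _
    have hv : Continuous (ρ.box w.2 g) := continuous_fourierMul _ _
    have : StronglyMeasurable (Function.uncurry fun (x y : Eu n) =>
        ρ.box (m + w.1 - w.2) f y * ρ.box w.2 g y * K (y - x)) := by
      refine Continuous.stronglyMeasurable ?_
      have hKc := K.continuous
      simp only [Function.uncurry_def]
      fun_prop
    exact this.integral_prod_right.aestronglyMeasurable
  have e : ρ.box m h = (normFactor n : ℂ) • ∑ w ∈ nearOrigin n ×ˢ L, G w := by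
    funext x
    rw [hL x, Pi.smul_apply, smul_eq_mul, Finset.sum_apply]
  rw [e, eLpNorm_const_smul, ← ρ.eLpNorm_fourierS_sigmaS m, mul_assoc]
  have hn : ‖(normFactor n : ℂ)‖ₑ = ENNReal.ofReal (normFactor n) := by
    rw [← ofReal_norm, Complex.norm_real, Real.norm_of_nonneg (normFactor_pos n).le]
  rw [hn]
  refine mul_le_mul_right ?_ _
  calc eLpNorm (∑ w ∈ nearOrigin n ×ˢ L, G w) p volume
      ≤ ∑ w ∈ nearOrigin n ×ˢ L, eLpNorm (G w) p volume := eLpNorm_sum_le (fun w _ => hGm w) hp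
    _ ≤ ∑ w ∈ nearOrigin n ×ˢ L, eLpNorm K 1 volume *
      (eLpNorm (ρ.box (m + w.1 - w.2) f) p₁ volume * eLpNorm (ρ.box w.2 g) p₂ volume) :=
        Finset.sum_le_sum fun w _ => hGle w
    _ ≤ _ := by
        rw [← Finset.mul_sum, Finset.sum_product]
        refine mul_le_mul_right (Finset.sum_le_sum fun r _ => ?_) _
        exact ENNReal.sum_le_tsum (f := fun l =>
          eLpNorm (ρ.box (m + r - l) f) p₁ volume * eLpNorm (ρ.box l g) p₂ volume) L

/-! ### The weighted sequence estimate -/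

/-- Two-sided comparability is needed because the exponent may have either sign. -/
theorem rpow_le_rpow_abs_mul {x y a : ℝ} (hx : 0 < x) (hy : 0 < y) (ha : 0 < a) (hxy : x ≤ a * y)
    (hyx : y ≤ a * x) (s : ℝ) : x ^ s ≤ a ^ |s| * y ^ s := by
  rcases le_total 0 s with hs | hs
  · rw [abs_of_nonneg hs, ← Real.mul_rpow ha.le hy.le]
    exact Real.rpow_le_rpow hx.le hxy hs
  · rw [abs_of_nonpos hs, Real.rpow_neg ha.le, ← Real.inv_rpow ha.le,
      ← Real.mul_rpow (inv_nonneg.2 ha.le) hy.le]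
    refine Real.rpow_le_rpow_of_nonpos (by positivity) ?_ hs
    rwa [inv_mul_le_iff₀ ha]

theorem bracket_le_mul {a : ℝ} (ha : 1 ≤ a) {ξ η : Eu n} (h : ‖ξ‖ ≤ a * ‖η‖) :
    bracket ξ ≤ a * bracket η := by
  have h1 : a * bracket η = Real.sqrt (a ^ 2 * (1 + ‖η‖ ^ 2)) := by
    rw [Real.sqrt_mul (by positivity), Real.sqrt_sq (by linarith), bracket]
  rw [h1, bracket]
  refine Real.sqrt_le_sqrt ?_
  have h2 : ‖ξ‖ ^ 2 ≤ (a * ‖η‖) ^ 2 := pow_le_pow_left₀ (norm_nonneg _) h 2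
  nlinarith

theorem bracket_le_of_norm_sub_le {D : ℝ} {ξ η : Eu n} (h : ‖ξ - η‖ ≤ D) :
    bracket ξ ≤ (1 + D) * bracket η := by
  have hD : 0 ≤ D := (norm_nonneg _).trans h
  have h1 : bracket ξ ≤ bracket η + D := by
    refine Real.sqrt_le_iff.2 ⟨by linarith [bracket_pos η], ?_⟩
    have h2 : ‖ξ‖ ≤ ‖η‖ + D := by linarith [norm_sub_norm_le ξ η]
    have h3 : bracket η ^ 2 = 1 + ‖η‖ ^ 2 := Real.sq_sqrt (by positivity)
    have h4 : ‖ξ‖ ^ 2 ≤ (‖η‖ + D) ^ 2 := pow_le_pow_left₀ (norm_nonneg _) h2 2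
    nlinarith [norm_le_bracket η]
  nlinarith [one_le_bracket η]

theorem norm_latticePt_le_of_abs_le {k l : Fin n → ℤ} (h : ∀ i, |(k i : ℝ)| ≤ |(l i : ℝ)|) :
    ‖latticePt k‖ ≤ ‖latticePt l‖ := by
  rw [EuclideanSpace.norm_eq, EuclideanSpace.norm_eq]
  refine Real.sqrt_le_sqrt (Finset.sum_le_sum fun i _ => ?_)
  exact pow_le_pow_left₀ (norm_nonneg _) (h i) 2

/-- With `k` the larger index, `⟨k + l⟩` is comparable to `⟨k⟩`. Since `s₀ - s₁ ≤ 0`, the surplus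
`⟨k⟩^(s₀ - s₁)` may be moved to the smaller index `l`. -/
theorem bracket_add_rpow_le {ε : Fin n → Fin 2} {R : ℝ} {k l : Fin n → ℤ}
    (hk : k ∈ orthantLattice ε R) (hl : l ∈ orthantLattice ε R)
    (hlk : ‖latticePt l‖ ≤ ‖latticePt k‖) {s₀ s₁ s₂ : ℝ} (h : s₀ ≤ s₁) :
    bracket (latticePt (k + l)) ^ s₀ ≤ 2 ^ |s₀| * (bracket (latticePt k) ^ s₁ *
      bracket (latticePt l) ^ s₂ * bracket (latticePt l) ^ (-(s₁ + s₂ - s₀))) := by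
  have hk0 := bracket_pos (latticePt k)
  have hl0 := bracket_pos (latticePt l)
  have h1 : bracket (latticePt (k + l)) ≤ 2 * bracket (latticePt k) := by
    refine bracket_le_mul one_le_two ?_
    rw [Window.latticePt_add]
    linarith [norm_add_le (latticePt k) (latticePt l)]
  have h2 : ‖latticePt k‖ ≤ ‖latticePt (k + l)‖ := by
    refine norm_latticePt_le_of_abs_le fun i => ?_
    rw [Pi.add_apply, ← abs_add_abs_of_mem_orthantLattice hk hl i]
    linarith [abs_nonneg (l i : ℝ)]
  have h3 : bracket (latticePt k) ≤ 2 * bracket (latticePt (k + l)) :=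
    bracket_le_mul one_le_two (by linarith [norm_nonneg (latticePt (k + l))])
  refine (rpow_le_rpow_abs_mul (bracket_pos _) hk0 two_pos h1 h3 s₀).trans ?_
  refine mul_le_mul_of_nonneg_left ?_ (by positivity)
  have h4 : bracket (latticePt l) ≤ bracket (latticePt k) := by
    simpa using bracket_le_mul le_rfl (by simpa using hlk)
  have h5 : bracket (latticePt k) ^ (s₀ - s₁) ≤ bracket (latticePt l) ^ (s₀ - s₁) :=
    Real.rpow_le_rpow_of_nonpos hl0 h4 (by linarith)
  calc bracket (latticePt k) ^ s₀
      = bracket (latticePt k) ^ s₁ * bracket (latticePt k) ^ (s₀ - s₁) := by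
        rw [← Real.rpow_add hk0]; ring_nf
    _ ≤ bracket (latticePt k) ^ s₁ * bracket (latticePt l) ^ (s₀ - s₁) :=
        mul_le_mul_of_nonneg_left h5 (by positivity)
    _ = _ := by
        rw [mul_assoc, ← Real.rpow_add hl0]; ring_nf

/-- The weight `⟨k⟩^s`. -/
def weight (s : ℝ) (k : Fin n → ℤ) : ℝ≥0∞ := ENNReal.ofReal (bracket (latticePt k) ^ s)

open Classical in
/-- The weight `⟨l⟩^{-t}`, restricted to the lattice points outside the cube of size `R - 1`. -/
def tailWeight (R t : ℝ) (l : Fin n → ℤ) : ℝ≥0∞ :=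
  if ∃ i, R - 1 < |(l i : ℝ)| then weight (-t) l else 0

theorem tailWeight_of_mem {ε : Fin n → Fin 2} {R : ℝ} {l : Fin n → ℤ}
    (hl : l ∈ orthantLattice ε R) (t : ℝ) : tailWeight R t l = weight (-t) l :=
  if_pos hl.2

/-- The sum of two tail weights covers both orderings of `|k|` and `|l|`: the decay always falls on
the smaller index. -/
theorem weight_add_le {ε : Fin n → Fin 2} {R : ℝ} {k l : Fin n → ℤ}
    (hk : k ∈ orthantLattice ε R) (hl : l ∈ orthantLattice ε R) {s₀ s₁ s₂ : ℝ} (h₁ : s₀ ≤ s₁)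
    (h₂ : s₀ ≤ s₂) :
    weight s₀ (k + l) ≤ ENNReal.ofReal (2 ^ |s₀|) * (weight s₁ k * weight s₂ l *
      (tailWeight R (s₁ + s₂ - s₀) l + tailWeight R (s₁ + s₂ - s₀) k)) := by
  have hb : ∀ (k : Fin n → ℤ) (s : ℝ), 0 ≤ bracket (latticePt k) ^ s := fun k s =>
    Real.rpow_nonneg (bracket_pos _).le _
  rw [tailWeight_of_mem hk, tailWeight_of_mem hl]
  rcases le_total ‖latticePt l‖ ‖latticePt k‖ with h | h
  · refine (ENNReal.ofReal_le_ofReal (bracket_add_rpow_le hk hl h h₁ (s₂ := s₂))).trans ?_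
    rw [ENNReal.ofReal_mul (by positivity), ENNReal.ofReal_mul (mul_nonneg (hb _ _) (hb _ _)),
      ENNReal.ofReal_mul (hb _ _)]
    exact mul_le_mul_right (mul_le_mul_right le_self_add _) _
  · have h3 := bracket_add_rpow_le hl hk h h₂ (s₂ := s₁)
    rw [add_comm l k, add_comm s₂ s₁, mul_comm (bracket (latticePt l) ^ s₂)] at h3
    refine (ENNReal.ofReal_le_ofReal h3).trans ?_
    rw [ENNReal.ofReal_mul (by positivity), ENNReal.ofReal_mul (mul_nonneg (hb _ _) (hb _ _)),
      ENNReal.ofReal_mul (hb _ _)]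
    exact mul_le_mul_right (mul_le_mul_right le_add_self _) _

theorem weight_le_of_mem_nearOrigin {m r : Fin n → ℤ} (hr : r ∈ nearOrigin n) (s : ℝ) :
    weight s m ≤ ENNReal.ofReal ((1 + (3 * Real.sqrt n + 1)) ^ |s|) * weight s (m + r) := by
  have h := mem_nearOrigin.1 hr
  rw [weight, weight, ← ENNReal.ofReal_mul (by positivity)]
  refine ENNReal.ofReal_le_ofReal (rpow_le_rpow_abs_mul (bracket_pos _) (bracket_pos _)
    (by positivity) (bracket_le_of_norm_sub_le ?_) (bracket_le_of_norm_sub_le ?_) s)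
  · rw [Window.latticePt_add, sub_add_cancel_left, norm_neg]
    exact h
  · rw [Window.latticePt_add, add_sub_cancel_left]
    exact h

/-- Young's inequality on the lattice. -/
theorem eLpNorm_tsum_mul_le (c u : (Fin n → ℤ) → ℝ≥0∞) (r : Fin n → ℤ) {q : ℝ≥0∞} (hq : 1 ≤ q) :
    eLpNorm (fun m : Fin n → ℤ => ∑' l, c (m + r - l) * u l) q Measure.count
      ≤ (∑' l, c l) * eLpNorm u q Measure.count := by
  have h := eLpNorm_lintegral_kernel_le (μ := (Measure.count : Measure (Fin n → ℤ)))
    (κ := fun m l => c (m + r - l)) (u := u) (A := ∑' l, c l) (measurable_of_countable _)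
    (measurable_of_countable _) (fun m => ?_) (fun l => ?_) hq
  · simpa only [lintegral_count] using h
  · rw [lintegral_count]
    exact ((Equiv.subLeft (m + r)).tsum_eq c).le
  · rw [lintegral_count, ← (Equiv.addRight (r - l)).tsum_eq c]
    refine (tsum_congr fun m => ?_).le
    rw [Equiv.coe_addRight, add_sub_assoc]

theorem tsum_mul_le_eLpNorm_mul_eLpNorm (a w : (Fin n → ℤ) → ℝ≥0∞) {q q' : ℝ≥0∞} (hq : 1 < q)
    (hqq' : 1 / q + 1 / q' = 1) :
    ∑' l, w l * a l ≤ eLpNorm w q' Measure.count * eLpNorm a q Measure.count := by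
  rw [← lintegral_count]
  exact lintegral_mul_le_eLpNorm_mul_eLpNorm (measurable_of_countable _).aemeasurable
    (measurable_of_countable _).aemeasurable hq hqq'

theorem exists_eLpNorm_tailWeight_le (n : ℕ) {q' : ℝ≥0∞} (hq0 : q' ≠ 0) (hqt : q' ≠ ⊤) {t : ℝ}
    (ht : n / q'.toReal < t) :
    ∃ C : ℝ, 0 ≤ C ∧ ∀ R : ℝ, 2 < R →
      eLpNorm (tailWeight (n := n) R t) q' Measure.count
        ≤ ENNReal.ofReal (C * (R - 2) ^ (-(t - n / q'.toReal))) := by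
  set r := q'.toReal with hr
  have hr0 : 0 < r := ENNReal.toReal_pos hq0 hqt
  have htr : (n : ℝ) < t * r := (div_lt_iff₀ hr0).1 ht
  obtain ⟨C, hC, h⟩ := tsum_bracket_tail_le htr
  refine ⟨C ^ (1 / r), by positivity, fun R hR => ?_⟩
  have hR0 : 0 < R - 2 := by linarith
  -- The least integer above `R - 1`, so an integer of modulus larger than `R - 1` has modulus at
  -- least `N`; moreover `N > R - 2`, and the exponent `n - t r` is negative.
  set N := ⌊R - 1⌋₊ + 1 with hN
  have hN1 : R - 1 < N := by
    rw [hN]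
    push_cast
    exact Nat.lt_floor_add_one _
  have h1 : ∑' l : Fin n → ℤ, tailWeight R t l ^ r ≤ ENNReal.ofReal (C * (R - 2) ^ (n - t * r)) := by
    refine le_trans (ENNReal.tsum_le_tsum fun l => ?_) ((h N (by omega)).trans ?_)
    · rw [tailWeight]
      split_ifs with h2 h3 h3
      · rw [weight, ENNReal.ofReal_rpow_of_nonneg (Real.rpow_nonneg (bracket_pos _).le _) hr0.le,
          ← Real.rpow_mul (bracket_pos _).le, neg_mul]
      · exfalso
        obtain ⟨i, hi⟩ := h2
        refine h3 ⟨i, ?_⟩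
        have h4 : ⌊R - 1⌋₊ < (l i).natAbs := by
          rw [Nat.floor_lt (by linarith), Nat.cast_natAbs, Int.cast_abs]
          exact hi
        rw [Int.abs_eq_natAbs]
        exact_mod_cast h4
      · rw [ENNReal.zero_rpow_of_pos hr0]
        exact zero_le
      · rw [ENNReal.zero_rpow_of_pos hr0]
    · refine ENNReal.ofReal_le_ofReal (mul_le_mul_of_nonneg_left ?_ hC)
      exact Real.rpow_le_rpow_of_nonpos hR0 (by linarith) (by linarith)
  rw [eLpNorm_eq_lintegral_rpow_enorm_toReal hq0 hqt, lintegral_count]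
  simp only [enorm_eq_self]
  refine (ENNReal.rpow_le_rpow h1 (by positivity)).trans_eq ?_
  rw [ENNReal.ofReal_rpow_of_nonneg (by positivity) (by positivity), Real.mul_rpow hC (by positivity),
    ← Real.rpow_mul hR0.le, ← hr]
  have e : (n - t * r) * (1 / r) = -(t - n / r) := by
    field_simp
    ring
  rw [e]

theorem weight_mul_tsum_le {ε : Fin n → Fin 2} {R : ℝ} {U V : (Fin n → ℤ) → ℝ≥0∞}
    (hU : ∀ k ∉ orthantLattice ε R, U k = 0) (hV : ∀ k ∉ orthantLattice ε R, V k = 0)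
    {s₀ s₁ s₂ : ℝ} (h₁ : s₀ ≤ s₁) (h₂ : s₀ ≤ s₂) {m r : Fin n → ℤ} (hr : r ∈ nearOrigin n) :
    weight s₀ m * ∑' l, U (m + r - l) * V l
      ≤ ENNReal.ofReal ((1 + (3 * Real.sqrt n + 1)) ^ |s₀|) * ENNReal.ofReal (2 ^ |s₀|) *
        (∑' l, (tailWeight R (s₁ + s₂ - s₀) (m + r - l) * (weight s₁ (m + r - l) * U (m + r - l)))
            * (weight s₂ l * V l) +
          ∑' l, (tailWeight R (s₁ + s₂ - s₀) (m + r - l) * (weight s₂ (m + r - l) * V (m + r - l)))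
            * (weight s₁ l * U l)) := by
  -- The second sum is reindexed by `l ↦ m + r - l`. In the form stated, the tail weight sits on the
  -- first convolution factor in both sums, the one to be measured in `ℓ¹`.
  rw [← (Equiv.subLeft (m + r)).tsum_eq fun l => (tailWeight R (s₁ + s₂ - s₀) (m + r - l) *
    (weight s₂ (m + r - l) * V (m + r - l))) * (weight s₁ l * U l), ← ENNReal.tsum_add,
    ← ENNReal.tsum_mul_left, ← ENNReal.tsum_mul_left]
  refine ENNReal.tsum_le_tsum fun l => ?_
  rw [Equiv.subLeft_apply, sub_sub_cancel]
  by_cases hk : m + r - l ∈ orthantLattice ε R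
  swap
  · simp [hU _ hk]
  by_cases hl : l ∈ orthantLattice ε R
  swap
  · simp [hV _ hl]
  have h := weight_add_le hk hl h₁ h₂
  rw [sub_add_cancel] at h
  refine (mul_le_mul_left ((weight_le_of_mem_nearOrigin hr s₀).trans
    (mul_le_mul_right h _)) _).trans_eq ?_
  ring

/-- The sequence-space form of the product estimate. -/
theorem eLpNorm_weight_mul_sum_le {ε : Fin n → Fin 2} {R : ℝ} {U V : (Fin n → ℤ) → ℝ≥0∞}
    (hU : ∀ k ∉ orthantLattice ε R, U k = 0) (hV : ∀ k ∉ orthantLattice ε R, V k = 0)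
    {s₀ s₁ s₂ : ℝ} (h₁ : s₀ ≤ s₁) (h₂ : s₀ ≤ s₂) {q q' : ℝ≥0∞} (hq : 1 < q)
    (hqq' : 1 / q + 1 / q' = 1) :
    eLpNorm (fun m => weight s₀ m * ∑ r ∈ nearOrigin n, ∑' l, U (m + r - l) * V l) q Measure.count
      ≤ ((nearOrigin n).card * (ENNReal.ofReal ((1 + (3 * Real.sqrt n + 1)) ^ |s₀|) *
        ENNReal.ofReal (2 ^ |s₀|) * 2)) *
        eLpNorm (tailWeight (n := n) R (s₁ + s₂ - s₀)) q' Measure.count *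
        eLpNorm (fun k => weight s₁ k * U k) q Measure.count *
        eLpNorm (fun k => weight s₂ k * V k) q Measure.count := by
  set C := ENNReal.ofReal ((1 + (3 * Real.sqrt n + 1)) ^ |s₀|) * ENNReal.ofReal (2 ^ |s₀|) with hC
  have hCt : C ≠ ⊤ := ENNReal.mul_ne_top ENNReal.ofReal_ne_top ENNReal.ofReal_ne_top
  set T := tailWeight (n := n) R (s₁ + s₂ - s₀) with hT
  set a := fun k => weight s₁ k * U k with ha
  set b := fun k => weight s₂ k * V k with hb
  -- Young puts `T x` in `ℓ¹` and `y` in `ℓ^q`; Hölder then splits the `ℓ¹` norm into `ℓ^q'` of `T`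
  -- and `ℓ^q` of `x`.
  have hY : ∀ (x y : (Fin n → ℤ) → ℝ≥0∞) r,
      eLpNorm (fun m => ∑' l, (T (m + r - l) * x (m + r - l)) * y l) q Measure.count
        ≤ eLpNorm T q' Measure.count * eLpNorm x q Measure.count * eLpNorm y q Measure.count :=
    fun x y r => (eLpNorm_tsum_mul_le (fun k => T k * x k) y r hq.le).trans
      (mul_le_mul_left (tsum_mul_le_eLpNorm_mul_eLpNorm x T hq hqq') _)
  set G : (Fin n → ℤ) → (Fin n → ℤ) → ℝ≥0∞ := fun r m =>
    ∑' l, (T (m + r - l) * a (m + r - l)) * b l + ∑' l, (T (m + r - l) * b (m + r - l)) * a l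
    with hG
  have hGle : ∀ r, eLpNorm (G r) q Measure.count ≤ 2 *
      (eLpNorm T q' Measure.count * eLpNorm a q Measure.count * eLpNorm b q Measure.count) := by
    intro r
    refine (eLpNorm_add_le (measurable_of_countable _).aestronglyMeasurable
      (measurable_of_countable _).aestronglyMeasurable hq.le).trans ?_
    rw [two_mul]
    refine add_le_add (hY a b r) ((hY b a r).trans_eq ?_)
    ring
  calc eLpNorm (fun m => weight s₀ m * ∑ r ∈ nearOrigin n, ∑' l, U (m + r - l) * V l) q
        Measure.count
      ≤ eLpNorm (∑ r ∈ nearOrigin n, fun m => C * G r m) q Measure.count := by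
        refine eLpNorm_mono_enorm fun m => ?_
        rw [enorm_eq_self, enorm_eq_self, Finset.sum_apply, Finset.mul_sum]
        exact Finset.sum_le_sum fun r hr => weight_mul_tsum_le hU hV h₁ h₂ hr
    _ ≤ ∑ r ∈ nearOrigin n, eLpNorm (fun m => C * G r m) q Measure.count :=
        eLpNorm_sum_le (fun r _ => (measurable_of_countable _).aestronglyMeasurable) hq.le
    _ ≤ ∑ r ∈ nearOrigin n, C * (2 * (eLpNorm T q' Measure.count * eLpNorm a q Measure.count *
          eLpNorm b q Measure.count)) := by
        refine Finset.sum_le_sum fun r _ => ?_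
        refine le_trans ?_ (mul_le_mul_right (hGle r) C)
        exact eLpNorm_le_mul_eLpNorm_of_ae_le_mul'' q
          (measurable_of_countable _).aestronglyMeasurable (ae_of_all _ fun m => by simp)
    _ = _ := by
        rw [Finset.sum_const, nsmul_eq_mul]
        ring

end

end ModulationSpaces

theorem proposition4p3 (n : ℕ) (ρ : Window n) (p₁ p₂ p q q' : ℝ≥0∞) (s₀ s₁ s₂ : ℝ)
    (hp₁ : 1 ≤ p₁) (hp₂ : 1 ≤ p₂) (hq : 1 < q) (hp : 1 ≤ p)
    (hpp : 1 / p = 1 / p₁ + 1 / p₂) (hqq' : 1 / q + 1 / q' = 1)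
    (hs₀ : s₀ ≤ min s₁ s₂) (hs₁ : 0 ≤ s₁) (hs₂ : 0 ≤ s₂)
    (hs : n / q'.toReal < s₁ + s₂ - s₀) :
    ∃ c : ℝ, 0 < c ∧ ∀ (R : ℝ), 2 < R → ∀ (ε : Fin n → Fin 2),
      ∀ f ∈ modSpaceOrthant ρ p₁ q s₁ ε R, ∀ g ∈ modSpaceOrthant ρ p₂ q s₂ ε R,
        ∃ h : 𝓢'(Eu n, ℂ), IsProduct f g h ∧ h ∈ modSpace ρ p q s₀ ∧
          modNorm ρ p q s₀ h ≤
            ENNReal.ofReal (c * (R - 2) ^ (-((s₁ + s₂ - s₀) - n / q'.toReal))) *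
              modNorm ρ p₁ q s₁ f * modNorm ρ p₂ q s₂ g := by
  have hq'0 : q' ≠ 0 := by
    rintro rfl
    simp at hqq'
  -- `q > 1` makes `q'` finite, so the tail norm is a genuine power series sum to which the lattice
  -- estimate applies.
  have hq't : q' ≠ ⊤ := by
    rintro rfl
    have h1 : q⁻¹ = 1 := by simpa using hqq'
    exact hq.ne' (ENNReal.inv_eq_one.1 h1)
  obtain ⟨C, hC, htail⟩ := exists_eLpNorm_tailWeight_le n hq'0 hq't hs
  set B : ℝ≥0∞ := ENNReal.ofReal (normFactor n) * eLpNorm (fourierS n (ρ.sigmaS 0)) 1 volume with hB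
  set A : ℝ≥0∞ := B * ((nearOrigin n).card * (ENNReal.ofReal ((1 + (3 * Real.sqrt n + 1)) ^ |s₀|) *
        ENNReal.ofReal (2 ^ |s₀|) * 2)) with hA
  have hBt : B ≠ ⊤ := ENNReal.mul_ne_top ENNReal.ofReal_ne_top
    ((fourierS n (ρ.sigmaS 0)).memLp 1 volume).eLpNorm_ne_top
  have hAt : A ≠ ⊤ := by
    refine ENNReal.mul_ne_top hBt (ENNReal.mul_ne_top (ENNReal.natCast_ne_top _) ?_)
    exact ENNReal.mul_ne_top (ENNReal.mul_ne_top ENNReal.ofReal_ne_top ENNReal.ofReal_ne_top)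
      ENNReal.ofNat_ne_top
  -- The summand `1` only ensures that the constant is strictly positive.
  refine ⟨A.toReal * C + 1, by positivity, fun R hR ε f hf g hg => ?_⟩
  obtain ⟨h, hprod, hsum⟩ := exists_product ρ hp hp₁ hp₂ hpp (zero_lt_one.trans hq).ne' hs₁ hs₂ hf hg
  have hR0 : 0 < R - 2 := by linarith
  have hU : ∀ k ∉ orthantLattice ε R, eLpNorm (ρ.box k f) p₁ volume = 0 := fun k hk => by
    rw [funext (box_eq_zero ρ hf.2 hk)]
    exact eLpNorm_zero'
  have hV : ∀ k ∉ orthantLattice ε R, eLpNorm (ρ.box k g) p₂ volume = 0 := fun k hk => by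
    rw [funext (box_eq_zero ρ hg.2 hk)]
    exact eLpNorm_zero'
  have hseq := eLpNorm_weight_mul_sum_le hU hV (hs₀.trans (min_le_left _ _))
    (hs₀.trans (min_le_right _ _)) hq hqq'
  have hbox : modNorm ρ p q s₀ h ≤ B * eLpNorm (fun m => weight s₀ m * ∑ r ∈ nearOrigin n,
      ∑' l, eLpNorm (ρ.box (m + r - l) f) p₁ volume * eLpNorm (ρ.box l g) p₂ volume) q
        Measure.count := by
    refine eLpNorm_le_mul_eLpNorm_of_ae_le_mul'' q
      (measurable_of_countable _).aestronglyMeasurable (ae_of_all _ fun m => ?_)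
    rw [enorm_eq_self, enorm_eq_self, mul_left_comm]
    exact mul_le_mul_right (eLpNorm_box_le ρ hp hpp hf.2 hg.2 hsum m) _
  have key : modNorm ρ p q s₀ h ≤
      ENNReal.ofReal ((A.toReal * C + 1) * (R - 2) ^ (-((s₁ + s₂ - s₀) - n / q'.toReal))) *
        modNorm ρ p₁ q s₁ f * modNorm ρ p₂ q s₂ g := by
    refine hbox.trans ((mul_le_mul_right hseq B).trans ?_)
    rw [← mul_assoc, ← mul_assoc, ← mul_assoc, ← hA]
    refine mul_le_mul_left (mul_le_mul_left ?_ _) _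
    refine (mul_le_mul_right (htail R hR) A).trans ?_
    rw [← ENNReal.ofReal_toReal hAt, ← ENNReal.ofReal_mul ENNReal.toReal_nonneg, ← mul_assoc,
      ENNReal.toReal_ofReal ENNReal.toReal_nonneg]
    refine ENNReal.ofReal_le_ofReal (mul_le_mul_of_nonneg_right ?_ (by positivity))
    linarith
  refine ⟨h, hprod, lt_of_le_of_lt key ?_, key⟩
  exact ENNReal.mul_lt_top (ENNReal.mul_lt_top ENNReal.ofReal_lt_top hf.1) hg.1
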